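/- Let $g:\mathbb R^d\to\mathbb R\cup\{+\infty\}$ be proper, lower semicontinuous, convex and nonnegative, and let $h:\mathbb R^d\to\mathbb R\cup\{+\infty\}$ be a Legendre function (proper, lower semicontinuous, strictly convex, differentiable on the interior of its domain, with $\|\nabla h\|$ diverging at every boundary point of the domain). Let $\mathcal X=\overline{\operatorname{dom} h}\cap\overline{\operatorname{dom} g}$ have non-empty interior, and let $\operatorname{int}\operatorname{dom} h\cap\operatorname{dom} g\neq\emptyset$. Let $(x_n,y_n)_{n\ge 1}$ be i.i.d. in $\mathbb R^d\times\mathbb R$ with $\mathbb E\|x_n\|_2^2<\infty$, $\mathbb E y_n^2<\infty$ and $\Sigma=\mathbb E[x_n\otimes x_n]$ invertible. Let $f(\theta)=\frac12\mathbb E(\langle x_n,\theta\rangle-y_n)^2$, let $\theta_\Sigma$ be its global minimizer, and let $\theta_*$ be a minimizer of $f+g$ over $\mathcal X$. Put $\xi_n=(y_n-\langle\theta_\Sigma,x_n\rangle)x_n$, assume that $\xi_n$ is square-integrable, put $C=\mathbb E[\xi_n\otimes\xi_n]$, and assume $C\preccurlyeq\sigma^2\Sigma$ for some $\sigma>0$.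 Write $\|v\|_A^2=\langle v,Av\rangle$. Assume that - there is $\kappa>0$ with $\mathbb E\langle z,x_n\rangle^4\le\kappa\langle z,\Sigma z\rangle^2$ for all $z\in\mathbb R^d$; - there is $L>0$ such that $Lh-\frac12\|\cdot\|_\Sigma^2$ is convex; - there are $b\in[0,1]$ and $\mu_b>0$ such that $h-\frac{\mu_b}{2}\|\cdot\|_{\Sigma^b}^2$ is convex. Let $\gamma>0$ satisfy $\gamma\le\min\big\{\frac{\mu_b}{4\kappa\operatorname{tr}\Sigma^{1-b}},\frac1{\kappa Ld}\big\}$. Let $\theta_0\in\operatorname{int}\operatorname{dom}h$, $\eta_0=\nabla h(\theta_0)$ and, for $n\ge1$, $\eta_n=\eta_{n-1}-\gamma(\langle x_n,\theta_{n-1}\rangle-y_n)x_n$ and $\theta_n=\nabla h_n^*(\eta_n)$, where $h_n=h+n\gamma g$ and $h_n^*$ is its convex conjugate. Let $\bar\theta_n=\frac1n\sum_{k=0}^{n-1}\theta_k$ and $D_h(\alpha,\beta)=h(\alpha)-h(\beta)-\langle\nabla h(\beta),\alpha-\beta\rangle$. Then, for every $n\ge1$, $$\tfrac12\mathbb E\|\bar\theta_n-\theta_*\|_\Sigma^2\le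 2\frac{D_h(\theta_*,\theta_0)}{\gamma n}+\frac{24}{n}\operatorname{tr}\Sigma^{-1}C+\frac{16\kappa d\gamma}{n\mu_b}\operatorname{tr}C\Sigma^{-b}+\frac{8\kappa d}{n}\Big(\frac{4\kappa\gamma\operatorname{tr}\Sigma^{1-b}}{\mu_b}+3\Big)\|\theta_*-\theta_\Sigma\|_\Sigma^2+80\frac{\kappa d}{\gamma n^2}D_h(\theta_*,\theta_0)+\frac{16\kappa d}{n^2}g(\theta_0),$$ where the right-hand side is $+\infty$ if $h(\theta_*)=+\infty$ or $g(\theta_0)=+\infty$. -/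

import Mathlib

open MeasureTheory ProbabilityTheory Filter Topology
open scoped Matrix ENNReal InnerProductSpace

noncomputable section

namespace SDA

/-! ### Extended-valued convex functions on `ℝ^d` -/

/-- Effective domain of an extended-valued function. -/
def effDom {d : ℕ} (F : EuclideanSpace ℝ (Fin d) → EReal) : Set (EuclideanSpace ℝ (Fin d)) :=
  {θ | F θ < ⊤}

/-- The finite part of an extended-valued function; only meaningful on `effDom F` for proper `F`. -/
def finPart {d : ℕ} (F : EuclideanSpace ℝ (Fin d) → EReal) (θ : EuclideanSpace ℝ (Fin d)) : ℝ :=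
  (F θ).toReal

/-- Proper: never `-∞` and not identically `+∞`. -/
def IsProper {d : ℕ} (F : EuclideanSpace ℝ (Fin d) → EReal) : Prop :=
  (∀ θ, F θ ≠ ⊥) ∧ (effDom F).Nonempty

/-- Proper lower semicontinuous convex function `ℝ^d → ℝ ∪ {+∞}`.  For a proper function, convexity
amounts to convexity of the effective domain and of the (real) values on it. -/
structure IsProperLscConvex {d : ℕ} (F : EuclideanSpace ℝ (Fin d) → EReal) : Prop where
  proper : IsProper F
  lsc : LowerSemicontinuous F
  convex : ConvexOn ℝ (effDom F) (finPart F)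

/-- Legendre function: proper, lower semicontinuous, strictly convex, differentiable on the interior
of its domain, with gradient diverging at the boundary of the domain. -/
structure IsLegendre {d : ℕ} (h : EuclideanSpace ℝ (Fin d) → EReal) : Prop where
  proper : IsProper h
  lsc : LowerSemicontinuous h
  strictConvex : StrictConvexOn ℝ (effDom h) (finPart h)
  differentiable : ∀ θ ∈ interior (effDom h), DifferentiableAt ℝ (finPart h) θ
  gradient_diverges : ∀ (u : ℕ → EuclideanSpace ℝ (Fin d)) (p : EuclideanSpace ℝ (Fin d)),
    (∀ k, u k ∈ interior (effDom h)) → p ∈ frontier (effDom h) → Tendsto u atTop (𝓝 p) →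
      Tendsto (fun k => ‖gradient (finPart h) (u k)‖) atTop atTop

/-- Convex conjugate `F^*(η) = sup_θ ⟨η, θ⟩ - F(θ)`. -/
def conj {d : ℕ} (F : EuclideanSpace ℝ (Fin d) → EReal) (η : EuclideanSpace ℝ (Fin d)) : EReal :=
  ⨆ θ : EuclideanSpace ℝ (Fin d), ((⟪η, θ⟫_ℝ : ℝ) : EReal) - F θ

/-- `F` is finite around `η` (as far as `+∞` goes) and has gradient `v` at `η`. -/
def HasExtGradientAt {d : ℕ} (F : EuclideanSpace ℝ (Fin d) → EReal)
    (v η : EuclideanSpace ℝ (Fin d)) : Prop :=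
  η ∈ interior (effDom F) ∧ HasGradientAt (finPart F) v η

/-- Bregman divergence `D_h(α, β) = h(α) - h(β) - ⟨∇h(β), α - β⟩`, for `β` in the interior of the
domain of `h`; it equals `+∞` when `α` is outside the domain of `h`. -/
def bregman {d : ℕ} (h : EuclideanSpace ℝ (Fin d) → EReal)
    (α β : EuclideanSpace ℝ (Fin d)) : EReal :=
  h α - ((finPart h β + ⟪gradient (finPart h) β, α - β⟫_ℝ : ℝ) : EReal)

/-! ### Matrices -/

/-- Squared Mahalanobis norm `‖v‖_A^2 = ⟨v, A v⟩`. -/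
def sqNorm {d : ℕ} (A : Matrix (Fin d) (Fin d) ℝ) (v : EuclideanSpace ℝ (Fin d)) : ℝ :=
  v.ofLp ⬝ᵥ (A *ᵥ v.ofLp)

/-- Real power `A ^ s` of a symmetric positive definite matrix (spectral calculus). -/
def matPow {d : ℕ} (A : Matrix (Fin d) (Fin d) ℝ) (s : ℝ) : Matrix (Fin d) (Fin d) ℝ :=
  cfc (fun t : ℝ => t ^ s) A

/-- Second moment matrix `𝔼[X ⊗ X]`. -/
def secondMoment {Ω : Type*} [MeasurableSpace Ω] {d : ℕ} (P : Measure Ω)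
    (X : Ω → EuclideanSpace ℝ (Fin d)) : Matrix (Fin d) (Fin d) ℝ :=
  Matrix.of fun i j => ∫ ω, X ω i * X ω j ∂P

/-! ### The least-squares problem and stochastic dual averaging -/

/-- Least-squares risk `f(θ) = (1/2) 𝔼 (⟨X, θ⟩ - Y)^2`. -/
def risk {Ω : Type*} [MeasurableSpace Ω] {d : ℕ} (P : Measure Ω)
    (X : Ω → EuclideanSpace ℝ (Fin d)) (Y : Ω → ℝ) (θ : EuclideanSpace ℝ (Fin d)) : ℝ :=
  (1 / 2) * ∫ ω, (⟪X ω, θ⟫_ℝ - Y ω) ^ 2 ∂P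

/-- Residual `(Y - ⟨X, θ⟩) X` at `θ`. -/
def residual {Ω : Type*} {d : ℕ} (X : Ω → EuclideanSpace ℝ (Fin d)) (Y : Ω → ℝ)
    (θ : EuclideanSpace ℝ (Fin d)) (ω : Ω) : EuclideanSpace ℝ (Fin d) :=
  (Y ω - ⟪X ω, θ⟫_ℝ) • X ω

/-- `h_n = h + n γ g` (in particular `h_0 = h`, by the convention `0 * ∞ = 0`). -/
def hReg {d : ℕ} (h g : EuclideanSpace ℝ (Fin d) → EReal) (γ : ℝ) (n : ℕ)
    (θ : EuclideanSpace ℝ (Fin d)) : EReal :=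
  h θ + ((n * γ : ℝ) : EReal) * g θ

/-- `(η_n, θ_n)` are the dual and primal iterates of stochastic dual averaging for least-squares,
with constant step-size `γ`, started at `θ_0 = θ₀`, `η_0 = ∇h(θ₀)`.
The `n`-th observation (`n ≥ 1`) is `(x (n - 1), y (n - 1))`. -/
structure IsSDA {Ω : Type*} {d : ℕ} (h g : EuclideanSpace ℝ (Fin d) → EReal) (γ : ℝ)
    (θ₀ : EuclideanSpace ℝ (Fin d)) (x : ℕ → Ω → EuclideanSpace ℝ (Fin d)) (y : ℕ → Ω → ℝ)
    (η θ : ℕ → Ω → EuclideanSpace ℝ (Fin d)) : Prop where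
  dual_zero : ∀ ω, η 0 ω = gradient (finPart h) θ₀
  primal_zero : ∀ ω, θ 0 ω = θ₀
  dual_succ : ∀ n ω,
    η (n + 1) ω = η n ω - γ • ((⟪x n ω, θ n ω⟫_ℝ - y n ω) • x n ω)
  primal_succ : ∀ n ω, HasExtGradientAt (conj (hReg h g γ (n + 1))) (θ (n + 1) ω) (η (n + 1) ω)

/-- Average `(1/n) ∑_{k=0}^{n-1} θ_k` of the primal iterates. -/
def average {Ω : Type*} {d : ℕ} (θ : ℕ → Ω → EuclideanSpace ℝ (Fin d)) (n : ℕ) (ω : Ω) :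
    EuclideanSpace ℝ (Fin d) :=
  (1 / (n : ℝ)) • ∑ k ∈ Finset.range n, θ k ω

end SDA

end

/-! Write `D` for the Bregman divergence from `θ₀` to `θstar`, `v_k` for the residual at `θ_k`, and
`m_k` for `v_k` minus its mean given the past, which is `-Σ(θ_k - θ_Σ)`. Since `θ_k` is the gradient
of a conjugate at `η_k`, it minimizes `h + kγg - ⟨η_k, ·⟩`; so `η_k` is a subgradient there, with a
quadratic gain in the norm of `Σ^b` (`IsSDA.strong_subgradient`). Two pathwise inequalities follow,
in which the noise enters linearly against past quantities, plus squares.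

Energy (`energy_inequality`): a duality-gap potential telescopes, and strong convexity pays for each
primal move against `‖v_k‖²` in the norm of `Σ^{-b}`. In expectation the linear noise vanishes, the
kurtosis bound controls the second moment of `v_k`, and the step size absorbs its `‖θ_k - θstar‖²`
part into the left side. The summed squared distances are then of order `1/γ + n`, which alone does
not give a `1/n` rate.

Average (`sqNorm_denoisedSum_le`): `η_k` is an affine function of `W_k = ∑_{j<k} (θ_j - θstar - Σ⁻¹
m_j)`. Testing subgradients against optimality of `θstar` bounds `⟨W_k, θ_k - θstar⟩_Σ` by `D/γ`,
uniformly in `k`, so the expectation of `‖W_k‖²` grows by at most `2D/γ` plus variance terms at each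
step. The removed sum of `Σ⁻¹ m_j` is a martingale with orthogonal increments. Both second moments
are therefore controlled by `n` plus the summed energy, and dividing by `n²` yields the rate. The
factor `κd` is `κ tr(Σ⁻¹Σ)`, from measuring the noise in the norm of `Σ⁻¹`. -/

namespace SDA

/-! ### Quadratic forms, dual norms and matrix powers -/

section LinearAlgebra

variable {d : ℕ}

/-- Bilinear form `⟨u, A v⟩` of a matrix. -/
def bil (A : Matrix (Fin d) (Fin d) ℝ) (u v : EuclideanSpace ℝ (Fin d)) : ℝ :=
  u.ofLp ⬝ᵥ (A *ᵥ v.ofLp)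

/-- Action of a matrix on Euclidean space. -/
def act (A : Matrix (Fin d) (Fin d) ℝ) (v : EuclideanSpace ℝ (Fin d)) :
    EuclideanSpace ℝ (Fin d) :=
  WithLp.toLp 2 (A *ᵥ v.ofLp)

lemma sqNorm_eq_bil (A : Matrix (Fin d) (Fin d) ℝ) (v : EuclideanSpace ℝ (Fin d)) :
    sqNorm A v = bil A v v := rfl

lemma inner_eq_dotProduct (u v : EuclideanSpace ℝ (Fin d)) : ⟪u, v⟫_ℝ = u.ofLp ⬝ᵥ v.ofLp := by
  rw [EuclideanSpace.inner_eq_star_dotProduct, dotProduct_comm]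
  simp

lemma inner_act_right (A : Matrix (Fin d) (Fin d) ℝ) (u v : EuclideanSpace ℝ (Fin d)) :
    ⟪u, act A v⟫_ℝ = bil A u v := by
  rw [inner_eq_dotProduct]; rfl

lemma bil_add_left (A : Matrix (Fin d) (Fin d) ℝ) (u v w : EuclideanSpace ℝ (Fin d)) :
    bil A (u + v) w = bil A u w + bil A v w := by
  simp [bil, add_dotProduct]

lemma bil_add_right (A : Matrix (Fin d) (Fin d) ℝ) (u v w : EuclideanSpace ℝ (Fin d)) :
    bil A u (v + w) = bil A u v + bil A u w := by
  simp [bil, Matrix.mulVec_add, dotProduct_add]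

lemma bil_sub_left (A : Matrix (Fin d) (Fin d) ℝ) (u v w : EuclideanSpace ℝ (Fin d)) :
    bil A (u - v) w = bil A u w - bil A v w := by
  simp [bil, sub_dotProduct]

lemma bil_sub_right (A : Matrix (Fin d) (Fin d) ℝ) (u v w : EuclideanSpace ℝ (Fin d)) :
    bil A u (v - w) = bil A u v - bil A u w := by
  simp [bil, Matrix.mulVec_sub, dotProduct_sub]

lemma bil_smul_left (A : Matrix (Fin d) (Fin d) ℝ) (c : ℝ) (u v : EuclideanSpace ℝ (Fin d)) :
    bil A (c • u) v = c * bil A u v := by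
  simp [bil]

lemma bil_smul_right (A : Matrix (Fin d) (Fin d) ℝ) (c : ℝ) (u v : EuclideanSpace ℝ (Fin d)) :
    bil A u (c • v) = c * bil A u v := by
  simp [bil, Matrix.mulVec_smul]

lemma bil_comm {A : Matrix (Fin d) (Fin d) ℝ} (hA : A.IsHermitian)
    (u v : EuclideanSpace ℝ (Fin d)) : bil A u v = bil A v u := by
  have hT : Aᵀ = A := by simpa [Matrix.IsHermitian] using hA
  unfold bil
  rw [Matrix.dotProduct_mulVec, dotProduct_comm, ← Matrix.mulVec_transpose, hT]

lemma bil_eq_sum (A : Matrix (Fin d) (Fin d) ℝ) (u v : EuclideanSpace ℝ (Fin d)) :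
    bil A u v = ∑ i, ∑ j, A i j * (u i * v j) := by
  simp only [bil, dotProduct, Matrix.mulVec, Finset.mul_sum]
  exact Finset.sum_congr rfl fun i _ => Finset.sum_congr rfl fun j _ => by ring

lemma bil_act_right (A B : Matrix (Fin d) (Fin d) ℝ) (u v : EuclideanSpace ℝ (Fin d)) :
    bil A u (act B v) = bil (A * B) u v := by
  simp [bil, act, Matrix.mulVec_mulVec]

lemma bil_one (u v : EuclideanSpace ℝ (Fin d)) : bil 1 u v = ⟪u, v⟫_ℝ := by
  rw [inner_eq_dotProduct]; simp [bil]

lemma bil_act_left {A B : Matrix (Fin d) (Fin d) ℝ} (hA : A.IsHermitian)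
    (u v : EuclideanSpace ℝ (Fin d)) :
    bil B (act A u) v = bil (A * B) u v := by
  have hT : Aᵀ = A := by simpa [Matrix.IsHermitian] using hA
  unfold bil act
  rw [← Matrix.mulVec_mulVec, Matrix.dotProduct_mulVec u.ofLp A, ← Matrix.mulVec_transpose, hT]

lemma act_eq_toEuclideanCLM (A : Matrix (Fin d) (Fin d) ℝ) (v : EuclideanSpace ℝ (Fin d)) :
    act A v = Matrix.toEuclideanCLM (𝕜 := ℝ) A v := by
  ext i; simp [act]

lemma continuous_act (A : Matrix (Fin d) (Fin d) ℝ) : Continuous (act A) := by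
  rw [funext (act_eq_toEuclideanCLM A)]
  exact ContinuousLinearMap.continuous _

lemma continuous_sqNorm (A : Matrix (Fin d) (Fin d) ℝ) : Continuous (sqNorm A) := by
  have : sqNorm A = fun v => ⟪v, act A v⟫_ℝ := by
    funext v; rw [inner_act_right]; rfl
  rw [this]
  exact continuous_id.inner (continuous_act A)

lemma abs_bil_le (A : Matrix (Fin d) (Fin d) ℝ) :
    ∃ K : ℝ, 0 < K ∧ ∀ u v, |bil A u v| ≤ K * (‖u‖ * ‖v‖) := by
  refine ⟨‖Matrix.toEuclideanCLM (𝕜 := ℝ) A‖ + 1, by positivity, fun u v => ?_⟩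
  rw [← inner_act_right, act_eq_toEuclideanCLM]
  calc |⟪u, Matrix.toEuclideanCLM (𝕜 := ℝ) A v⟫_ℝ|
      ≤ ‖u‖ * ‖Matrix.toEuclideanCLM (𝕜 := ℝ) A v‖ := abs_real_inner_le_norm _ _
    _ ≤ ‖u‖ * (‖Matrix.toEuclideanCLM (𝕜 := ℝ) A‖ * ‖v‖) := by
        gcongr; exact ContinuousLinearMap.le_opNorm _ _
    _ ≤ _ := by nlinarith [mul_nonneg (norm_nonneg u) (norm_nonneg v)]

lemma sqNorm_nonneg {A : Matrix (Fin d) (Fin d) ℝ} (hA : A.PosSemidef)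
    (v : EuclideanSpace ℝ (Fin d)) : 0 ≤ sqNorm A v := by
  simpa [sqNorm] using hA.dotProduct_mulVec_nonneg v.ofLp

lemma sqNorm_pos {S : Matrix (Fin d) (Fin d) ℝ} (hS : S.PosDef) {v : EuclideanSpace ℝ (Fin d)}
    (hv : v ≠ 0) : 0 < sqNorm S v := by
  have := hS.dotProduct_mulVec_pos (x := v.ofLp) (by simpa using hv)
  simpa [sqNorm] using this

lemma sqNorm_smul (A : Matrix (Fin d) (Fin d) ℝ) (c : ℝ) (v : EuclideanSpace ℝ (Fin d)) :
    sqNorm A (c • v) = c ^ 2 * sqNorm A v := by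
  simp only [sqNorm_eq_bil, bil_smul_left, bil_smul_right]; ring

lemma sqNorm_add {A : Matrix (Fin d) (Fin d) ℝ} (hA : A.IsHermitian)
    (u v : EuclideanSpace ℝ (Fin d)) :
    sqNorm A (u + v) = sqNorm A u + 2 * bil A u v + sqNorm A v := by
  simp only [sqNorm_eq_bil, bil_add_left, bil_add_right, bil_comm hA v u]; ring

lemma sqNorm_sub {A : Matrix (Fin d) (Fin d) ℝ} (hA : A.IsHermitian)
    (u v : EuclideanSpace ℝ (Fin d)) :
    sqNorm A (u - v) = sqNorm A u - 2 * bil A u v + sqNorm A v := by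
  simp only [sqNorm_eq_bil, bil_sub_left, bil_sub_right, bil_comm hA v u]; ring

/-- Weighted triangle inequality with weights `p⁻¹ + q⁻¹ + r⁻¹ = 1`, case `2, 4, 4`. -/
lemma sqNorm_add_three_le {A : Matrix (Fin d) (Fin d) ℝ} (hA : A.PosSemidef)
    (u v w : EuclideanSpace ℝ (Fin d)) :
    sqNorm A (u + v + w) ≤ 2 * sqNorm A u + 4 * sqNorm A v + 4 * sqNorm A w := by
  have h1 := sqNorm_nonneg hA (u - (v + w))
  have h2 := sqNorm_nonneg hA (v - w)
  rw [sqNorm_sub hA.1, bil_add_right, sqNorm_add hA.1] at h1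
  rw [sqNorm_sub hA.1] at h2
  rw [add_assoc, sqNorm_add hA.1, bil_add_right, sqNorm_add hA.1]
  linarith

/-- These weights serve the `S⁻¹` norm of the noise: they lead to the factor `7 = 1 + 2 * 3` in
`combine_bounds`, whereas weights `2, 4, 4` would give `9` and a coefficient `18 > 16` in front of
`g(θ₀)`. -/
lemma sqNorm_add_three_le' {A : Matrix (Fin d) (Fin d) ℝ} (hA : A.PosSemidef)
    (u v w : EuclideanSpace ℝ (Fin d)) :
    sqNorm A (u + v + w) ≤ 3 * sqNorm A u + 3 * sqNorm A v + 3 * sqNorm A w := by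
  have h1 := sqNorm_nonneg hA (u - v)
  have h2 := sqNorm_nonneg hA (v - w)
  have h3 := sqNorm_nonneg hA (u - w)
  rw [sqNorm_sub hA.1] at h1 h2 h3
  rw [add_assoc, sqNorm_add hA.1, bil_add_right, sqNorm_add hA.1]
  linarith

lemma sqNorm_add_le {A : Matrix (Fin d) (Fin d) ℝ} (hA : A.PosSemidef)
    (u v : EuclideanSpace ℝ (Fin d)) :
    sqNorm A (u + v) ≤ 2 * sqNorm A u + 2 * sqNorm A v := by
  have h1 := sqNorm_nonneg hA (u - v)
  rw [sqNorm_sub hA.1] at h1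
  rw [sqNorm_add hA.1]
  linarith

/-- Young's inequality for a pair of dual Mahalanobis norms. -/
lemma inner_le_young {A B : Matrix (Fin d) (Fin d) ℝ} (hA : A.PosSemidef) (hB : B.IsHermitian)
    (hAB : A * B = 1) {c : ℝ} (hc : 0 < c) (u v : EuclideanSpace ℝ (Fin d)) :
    ⟪u, v⟫_ℝ ≤ 1 / (2 * c) * sqNorm B u + c / 2 * sqNorm A v := by
  -- Because `A` and `B` are inverse, the cross term of this square is `⟪u, v⟫` and `‖B u‖²` in the
  -- norm of `A` is `‖u‖²` in the norm of `B`.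
  have h1 := sqNorm_nonneg hA (c • v - act B u)
  have hBA : B * A = 1 := mul_eq_one_comm.mp hAB
  have e1 : bil A v (act B u) = ⟪u, v⟫_ℝ := by
    rw [bil_act_right, hAB, bil_one, real_inner_comm]
  have e2 : sqNorm A (act B u) = sqNorm B u := by
    rw [sqNorm_eq_bil, bil_act_right, hAB, bil_act_left hB, mul_one]; rfl
  rw [sqNorm_sub hA.1, sqNorm_smul, bil_smul_left, e1, e2] at h1
  have h2 : 1 / (2 * c) * sqNorm B u + c / 2 * sqNorm A v - ⟪u, v⟫_ℝ
      = 1 / (2 * c) * (c ^ 2 * sqNorm A v - 2 * (c * ⟪u, v⟫_ℝ) + sqNorm B u) := by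
    field_simp; ring
  have h3 : 0 ≤ 1 / (2 * c) * (c ^ 2 * sqNorm A v - 2 * (c * ⟪u, v⟫_ℝ) + sqNorm B u) := by
    positivity
  linarith

/-- Young's inequality with `u = v` and weight `K`, a bound for `B`, costs only half of `‖v‖²` on
the `B` side. This coercivity of `M` drives existence of minimizers and integrability of the
iterates. -/
lemma exists_mul_norm_sq_le_sqNorm {A B : Matrix (Fin d) (Fin d) ℝ} (hA : A.PosSemidef)
    (hB : B.IsHermitian) (hAB : A * B = 1) :
    ∃ c : ℝ, 0 < c ∧ ∀ v, c * ‖v‖ ^ 2 ≤ sqNorm A v := by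
  obtain ⟨K, hK, hKB⟩ := abs_bil_le B
  refine ⟨1 / K, by positivity, fun v => ?_⟩
  have h1 := inner_le_young hA hB hAB hK v v
  have h2 := (le_abs_self _).trans (hKB v v)
  rw [← sqNorm_eq_bil] at h2
  rw [real_inner_self_eq_norm_sq] at h1
  have h3 : 1 / (2 * K) * sqNorm B v ≤ 1 / (2 * K) * (K * (‖v‖ * ‖v‖)) := by gcongr
  have h4 : 1 / (2 * K) * (K * (‖v‖ * ‖v‖)) = ‖v‖ ^ 2 / 2 := by field_simp
  have h5 : ‖v‖ ^ 2 ≤ K * sqNorm A v := by linarith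
  rw [one_div, inv_mul_le_iff₀ hK]
  exact h5

/-- Positivity of the spectrum is what makes negative powers continuous on it and real powers
additive in the exponent. -/
lemma matPow_mul_matPow {S : Matrix (Fin d) (Fin d) ℝ} (hS : S.PosDef) (s t : ℝ) :
    matPow S s * matPow S t = matPow S (s + t) := by
  have hpos : ∀ z ∈ spectrum ℝ S, 0 < z := by
    intro z hz
    rw [hS.1.spectrum_real_eq_range_eigenvalues] at hz
    obtain ⟨i, rfl⟩ := hz
    exact hS.eigenvalues_pos i
  have hc : ∀ r : ℝ, ContinuousOn (fun z : ℝ => z ^ r) (spectrum ℝ S) := fun r z hz =>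
    (Real.continuousAt_rpow_const z r (Or.inl (hpos z hz).ne')).continuousWithinAt
  unfold matPow
  rw [← cfc_mul _ _ S (hc s) (hc t)]
  exact cfc_congr fun z hz => (Real.rpow_add (hpos z hz) s t).symm

lemma matPow_zero {S : Matrix (Fin d) (Fin d) ℝ} (hS : S.PosDef) : matPow S 0 = 1 := by
  unfold matPow
  simp only [Real.rpow_zero]
  exact cfc_const_one ℝ S (ha := hS.1)

lemma matPow_one {S : Matrix (Fin d) (Fin d) ℝ} (hS : S.PosDef) : matPow S 1 = S := by
  unfold matPow
  simp only [Real.rpow_one]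
  exact cfc_id' ℝ S (ha := hS.1)

lemma isHermitian_matPow (S : Matrix (Fin d) (Fin d) ℝ) (s : ℝ) :
    (matPow S s).IsHermitian := cfc_predicate _ S

lemma posSemidef_matPow {S : Matrix (Fin d) (Fin d) ℝ} (hS : S.PosDef) (s : ℝ) :
    (matPow S s).PosSemidef := by
  have h : matPow S s = (matPow S (s / 2))ᴴ * matPow S (s / 2) := by
    rw [(isHermitian_matPow S (s / 2)).eq, matPow_mul_matPow hS]; norm_num
  rw [h]
  exact Matrix.posSemidef_conjTranspose_mul_self _

/-- A positive semidefinite quadratic form is a sum of squares of linear forms. -/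
lemma exists_sum_sq {M : Matrix (Fin d) (Fin d) ℝ} (hM : M.PosSemidef) :
    ∃ r : Fin d → EuclideanSpace ℝ (Fin d), (∀ v, sqNorm M v = ∑ j, ⟪r j, v⟫_ℝ ^ 2) ∧
      ∀ S : Matrix (Fin d) (Fin d) ℝ, (M * S).trace = ∑ j, sqNorm S (r j) := by
  obtain ⟨B, hB⟩ : ∃ B : Matrix (Fin d) (Fin d) ℝ, M = Bᵀ * B := by
    open scoped MatrixOrder in
    obtain ⟨B, hB⟩ := CStarAlgebra.nonneg_iff_eq_star_mul_self.mp hM.nonneg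
    exact ⟨B, by simpa [Matrix.star_eq_conjTranspose] using hB⟩
  -- The linear forms are the rows of `B`, where `M = Bᵀ * B`.
  refine ⟨fun j => WithLp.toLp 2 (B j), fun v => ?_, fun S => ?_⟩
  · rw [sqNorm, hB, ← Matrix.mulVec_mulVec, Matrix.dotProduct_mulVec, ← Matrix.mulVec_transpose,
      Matrix.transpose_transpose]
    simp only [inner_eq_dotProduct, dotProduct, Matrix.mulVec, sq]
  · rw [hB, Matrix.mul_assoc, Matrix.trace_mul_comm]
    simp only [Matrix.trace, Matrix.diag, Matrix.mul_assoc]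
    refine Finset.sum_congr rfl fun j _ => ?_
    rw [← Matrix.mul_assoc, Matrix.mul_apply]
    simp only [sqNorm, dotProduct, Matrix.mulVec, Matrix.mul_apply, Matrix.transpose_apply,
      Finset.mul_sum, Finset.sum_mul]
    rw [Finset.sum_comm]
    exact Finset.sum_congr rfl fun i _ => Finset.sum_congr rfl fun j _ => by ring

end LinearAlgebra

/-! ### Minimizers, conjugates and first-order conditions -/

section ConvexAnalysis

variable {d : ℕ}

/-- Used after moving a distance `t` along a segment and dividing by `t`: the second-order remainder
`t * c` disappears as `t → 0`. -/
lemma le_of_forall_sub_mul_le {a b c : ℝ} (h : ∀ t ∈ Set.Ioo (0 : ℝ) 1, b - t * c ≤ a) :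
    b ≤ a := by
  have hlim : Tendsto (fun t : ℝ => b - t * c) (𝓝[>] 0) (𝓝 b) := by
    have : ContinuousAt (fun t : ℝ => b - t * c) 0 := by fun_prop
    have h2 := this.tendsto
    simp only [zero_mul, sub_zero] at h2
    exact h2.mono_left nhdsWithin_le_nhds
  refine le_of_tendsto hlim ?_
  filter_upwards [Ioo_mem_nhdsGT (zero_lt_one' ℝ)] with t ht using h t ht

/-- Quadratic growth of a strongly convex function above its minimizer, up to a linear term. -/
lemma add_sqNorm_le_of_isMin {s : Set (EuclideanSpace ℝ (Fin d))}
    {φ : EuclideanSpace ℝ (Fin d) → ℝ} {M : Matrix (Fin d) (Fin d) ℝ} (hM : M.IsHermitian) {c : ℝ}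
    (hφ : ConvexOn ℝ s fun v => φ v - c * sqNorm M v) {p e : EuclideanSpace ℝ (Fin d)} (hp : p ∈ s)
    (hmin : ∀ q ∈ s, φ p + ⟪e, q - p⟫_ℝ ≤ φ q) {q : EuclideanSpace ℝ (Fin d)} (hq : q ∈ s) :
    φ p + ⟪e, q - p⟫_ℝ + c * sqNorm M (q - p) ≤ φ q := by
  refine le_of_forall_sub_mul_le (c := c * sqNorm M (q - p)) fun t ht => ?_
  have h1 : (1 - t) • p + t • q ∈ s :=
    hφ.1 hp hq (by linarith [ht.2]) ht.1.le (by ring)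
  have h2 := hφ.2 hp hq (show 0 ≤ 1 - t by linarith [ht.2]) ht.1.le (by ring)
  have h3 := hmin _ h1
  have e1 : (1 - t) • p + t • q - p = t • (q - p) := by module
  rw [e1, inner_smul_right] at h3
  -- The defect `t (1 - t)` in the convexity of a square is exactly the quadratic gain sought, once
  -- divided by `t`.
  have e2 : sqNorm M ((1 - t) • p + t • q)
      = (1 - t) * sqNorm M p + t * sqNorm M q - t * (1 - t) * sqNorm M (q - p) := by
    rw [sqNorm_add hM, sqNorm_sub hM, sqNorm_smul, sqNorm_smul, bil_smul_left, bil_smul_right,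
      bil_comm hM q p]
    ring
  simp only [smul_eq_mul, e2] at h2
  have h4 : t * (φ p + ⟪e, q - p⟫_ℝ + c * sqNorm M (q - p) - t * (c * sqNorm M (q - p)))
      ≤ t * φ q := by
    nlinarith
  exact le_of_mul_le_mul_left h4 ht.1

/-- Gradient inequality for a convex function at an interior point of its domain. -/
lemma add_inner_gradient_le {s : Set (EuclideanSpace ℝ (Fin d))}
    {φ : EuclideanSpace ℝ (Fin d) → ℝ} (hφ : ConvexOn ℝ s φ) {p : EuclideanSpace ℝ (Fin d)}
    (hp : p ∈ s) (hd : DifferentiableAt ℝ φ p) {q : EuclideanSpace ℝ (Fin d)} (hq : q ∈ s) :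
    φ p + ⟪gradient φ p, q - p⟫_ℝ ≤ φ q := by
  have hgrad := hd.hasGradientAt.hasFDerivAt
  have hline : HasDerivAt (fun t : ℝ => p + t • (q - p)) (q - p) 0 := by
    simpa using ((hasDerivAt_id (0 : ℝ)).smul_const (q - p)).const_add p
  have hcomp : HasDerivAt (fun t : ℝ => φ (p + t • (q - p))) ⟪gradient φ p, q - p⟫_ℝ 0 := by
    have h0 : p + (0 : ℝ) • (q - p) = p := by simp
    exact HasFDerivAt.comp_hasDerivAt (x := (0 : ℝ)) (f := fun t : ℝ => p + t • (q - p))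
      (l := φ) (l' := (InnerProductSpace.toDual ℝ _) (gradient φ p)) (by rw [h0]; exact hgrad) hline
  have hslope := hcomp.tendsto_slope_zero_right
  have hle : ⟪gradient φ p, q - p⟫_ℝ ≤ φ q - φ p := by
    refine le_of_tendsto hslope ?_
    filter_upwards [Ioo_mem_nhdsGT (zero_lt_one' ℝ)] with t ht
    have h2 := hφ.2 hp hq (show 0 ≤ 1 - t by linarith [ht.2]) ht.1.le (by ring)
    have e1 : (1 - t) • p + t • q = p + t • (q - p) := by module
    rw [e1] at h2
    simp only [smul_eq_mul, zero_add, zero_smul, add_zero] at h2 ⊢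
    rw [inv_mul_le_iff₀ ht.1]
    linarith
  linarith

lemma coe_finPart {F : EuclideanSpace ℝ (Fin d) → EReal} (hbot : ∀ θ, F θ ≠ ⊥)
    {θ : EuclideanSpace ℝ (Fin d)} (h : θ ∈ effDom F) : ((finPart F θ : ℝ) : EReal) = F θ :=
  EReal.coe_toReal (ne_of_lt h) (hbot θ)

/-- A lower semicontinuous function with quadratic growth attains its minimum, also after adding
a linear term. -/
lemma exists_isMin_of_growth {F : EuclideanSpace ℝ (Fin d) → EReal} (hlsc : LowerSemicontinuous F)
    {a c : ℝ} (hc : 0 < c) {p₀ w : EuclideanSpace ℝ (Fin d)} (hp₀ : p₀ ∈ effDom F)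
    (hgrow : ∀ θ, ((a + ⟪w, θ - p₀⟫_ℝ + c * ‖θ - p₀‖ ^ 2 : ℝ) : EReal) ≤ F θ)
    (η : EuclideanSpace ℝ (Fin d)) :
    ∃ p ∈ effDom F, ∀ q ∈ effDom F, finPart F p + ⟪η, q - p⟫_ℝ ≤ finPart F q := by
  have hbot : ∀ θ, F θ ≠ ⊥ := fun θ h => by
    have := hgrow θ
    rw [h, le_bot_iff] at this
    exact EReal.coe_ne_bot _ this
  set Φ : EuclideanSpace ℝ (Fin d) → EReal := fun q => F q + ((-⟪η, q - p₀⟫_ℝ : ℝ) : EReal) with hΦ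
  have hΦlsc : LowerSemicontinuous Φ := by
    refine hlsc.add' ?_ fun x => EReal.continuousAt_add (Or.inr (EReal.coe_ne_bot _))
      (Or.inr (EReal.coe_ne_top _))
    exact (continuous_coe_real_ereal.comp (by fun_prop)).lowerSemicontinuous
  -- Outside this ball the quadratic growth beats the linear tilt `‖w - η‖` and the gap `|F p₀ -
  -- a|`, so the tilted function exceeds its value at `p₀`; the `+ 1` outside the quotient ensures
  -- `R ≥ 1`.
  set R : ℝ := (‖w - η‖ + |finPart F p₀ - a| + 1) / c + 1 with hR
  have hRpos : 0 < R := by positivity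
  obtain ⟨p, hpR, hpmin⟩ := LowerSemicontinuousOn.exists_isMinOn
    (s := Metric.closedBall p₀ R) ⟨p₀, Metric.mem_closedBall_self hRpos.le⟩
    (isCompact_closedBall p₀ R) (hΦlsc.lowerSemicontinuousOn _)
  have hΦp₀ : Φ p₀ = ((finPart F p₀ : ℝ) : EReal) := by
    simp [hΦ, coe_finPart hbot hp₀]
  have hglob : ∀ q, Φ p ≤ Φ q := by
    intro q
    by_cases hq : q ∈ Metric.closedBall p₀ R
    · exact hpmin hq
    refine (hpmin (Metric.mem_closedBall_self hRpos.le)).trans ?_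
    rw [hΦp₀]
    have hqR : R < ‖q - p₀‖ := by
      rw [Metric.mem_closedBall, not_le, dist_eq_norm] at hq; exact hq
    have h1 : finPart F p₀ ≤ a + ⟪w, q - p₀⟫_ℝ + c * ‖q - p₀‖ ^ 2 + -⟪η, q - p₀⟫_ℝ := by
      have h2 : -(‖w - η‖ * ‖q - p₀‖) ≤ ⟪w - η, q - p₀⟫_ℝ :=
        (abs_le.mp (abs_real_inner_le_norm _ _)).1
      rw [inner_sub_left] at h2
      have h3 : ‖w - η‖ + |finPart F p₀ - a| + 1 + c ≤ c * ‖q - p₀‖ := by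
        have := mul_le_mul_of_nonneg_left hqR.le hc.le
        have e : c * R = ‖w - η‖ + |finPart F p₀ - a| + 1 + c := by rw [hR]; field_simp
        linarith
      have h4 : 1 ≤ ‖q - p₀‖ := by
        have : 1 ≤ R := by rw [hR]; have : 0 ≤ (‖w - η‖ + |finPart F p₀ - a| + 1) / c := by positivity
                           linarith
        linarith
      have h5 := mul_le_mul_of_nonneg_right h3 (norm_nonneg (q - p₀))
      have h6 := le_abs_self (finPart F p₀ - a)
      have h7 : |finPart F p₀ - a| ≤ |finPart F p₀ - a| * ‖q - p₀‖ :=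
        le_mul_of_one_le_right (abs_nonneg _) h4
      nlinarith
    calc ((finPart F p₀ : ℝ) : EReal)
        ≤ ((a + ⟪w, q - p₀⟫_ℝ + c * ‖q - p₀‖ ^ 2 + -⟪η, q - p₀⟫_ℝ : ℝ) : EReal) := by
          exact_mod_cast h1
      _ = ((a + ⟪w, q - p₀⟫_ℝ + c * ‖q - p₀‖ ^ 2 : ℝ) : EReal) + ((-⟪η, q - p₀⟫_ℝ : ℝ) : EReal) := by
          rw [EReal.coe_add]
      _ ≤ Φ q := add_le_add (hgrow q) le_rfl
  have hpdom : p ∈ effDom F := by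
    have h1 := hglob p₀
    rw [hΦp₀] at h1
    by_contra hcon
    have h2 : F p = ⊤ := by simpa [effDom] using hcon
    simp [hΦ, h2] at h1
  refine ⟨p, hpdom, fun q hq => ?_⟩
  have h1 := hglob q
  simp only [hΦ, ← coe_finPart hbot hpdom, ← coe_finPart hbot hq] at h1
  have h2 : finPart F p + -⟪η, p - p₀⟫_ℝ ≤ finPart F q + -⟪η, q - p₀⟫_ℝ := by exact_mod_cast h1
  have h3 : ⟪η, q - p⟫_ℝ = ⟪η, q - p₀⟫_ℝ - ⟪η, p - p₀⟫_ℝ := by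
    rw [← inner_sub_right]; congr 1; abel
  linarith

/-- The gradient of the conjugate of `F` at `η` is the point that attains the supremum. -/
lemma HasExtGradientAt.eq_of_isMin {F : EuclideanSpace ℝ (Fin d) → EReal} (hbot : ∀ θ, F θ ≠ ⊥)
    {η θ p : EuclideanSpace ℝ (Fin d)} (hp : p ∈ effDom F)
    (hmin : ∀ q ∈ effDom F, finPart F p + ⟪η, q - p⟫_ℝ ≤ finPart F q)
    (hθ : HasExtGradientAt (conj F) θ η) : θ = p := by
  have hge : ∀ η', ((⟪η', p⟫_ℝ - finPart F p : ℝ) : EReal) ≤ conj F η' := by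
    intro η'
    refine le_trans (le_of_eq ?_) (le_iSup (fun q => ((⟪η', q⟫_ℝ : ℝ) : EReal) - F q) p)
    rw [EReal.coe_sub, coe_finPart hbot hp]
  have hle : conj F η ≤ ((⟪η, p⟫_ℝ - finPart F p : ℝ) : EReal) := by
    refine iSup_le fun q => ?_
    by_cases hq : q ∈ effDom F
    · rw [← coe_finPart hbot hq, ← EReal.coe_sub, EReal.coe_le_coe_iff]
      have := hmin q hq
      rw [inner_sub_right] at this
      linarith
    · have : F q = ⊤ := by simpa [effDom] using hq
      rw [this, EReal.sub_top]
      exact bot_le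
  have hval : finPart (conj F) η = ⟪η, p⟫_ℝ - finPart F p := by
    rw [finPart, le_antisymm hle (hge η), EReal.toReal_coe]
  obtain ⟨hint, hgrad⟩ := hθ
  -- The function `η' ↦ F*(η') - ⟪η', p⟫` is at least `-F(p)`, with equality at `η`, so its gradient
  -- `θ - p` vanishes. Only near `η` is the conjugate known to be finite, hence a local minimum.
  have hmin' : IsLocalMin (fun η' => finPart (conj F) η' - ⟪η', p⟫_ℝ) η := by
    filter_upwards [mem_interior_iff_mem_nhds.mp hint] with η' hη'
    rw [hval]
    have h1 := EReal.toReal_le_toReal (hge η') (EReal.coe_ne_bot _) (ne_of_lt hη')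
    rw [EReal.toReal_coe] at h1
    change _ ≤ finPart (conj F) η' at h1
    linarith
  have hlin : HasFDerivAt (fun η' : EuclideanSpace ℝ (Fin d) => ⟪η', p⟫_ℝ)
      ((InnerProductSpace.toDual ℝ _) p) η := by
    have := ((InnerProductSpace.toDual ℝ (EuclideanSpace ℝ (Fin d))) p).hasFDerivAt (x := η)
    refine this.congr_of_eventuallyEq (Eventually.of_forall fun η' => ?_)
    simp [real_inner_comm]
  have h0 := hmin'.hasFDerivAt_eq_zero (hgrad.hasFDerivAt.sub hlin)
  rw [← map_sub] at h0
  exact sub_eq_zero.mp ((InnerProductSpace.toDual ℝ _).map_eq_zero_iff.mp h0)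

/-- First-order optimality of a minimizer of a quadratic plus a convex function. -/
lemma inner_ge_of_isMin_quadratic {s : Set (EuclideanSpace ℝ (Fin d))}
    {φ : EuclideanSpace ℝ (Fin d) → ℝ} (hφ : ConvexOn ℝ s φ) {S : Matrix (Fin d) (Fin d) ℝ}
    (hS : S.IsHermitian) {p z : EuclideanSpace ℝ (Fin d)} (hp : p ∈ s)
    (hmin : ∀ q ∈ s, 1 / 2 * sqNorm S (p - z) + φ p ≤ 1 / 2 * sqNorm S (q - z) + φ q)
    {q : EuclideanSpace ℝ (Fin d)} (hq : q ∈ s) :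
    φ p - φ q ≤ bil S (p - z) (q - p) := by
  refine le_of_forall_sub_mul_le (c := 1 / 2 * sqNorm S (q - p)) fun t ht => ?_
  have h1 : (1 - t) • p + t • q ∈ s :=
    hφ.1 hp hq (by linarith [ht.2]) ht.1.le (by ring)
  have h2 := hφ.2 hp hq (show 0 ≤ 1 - t by linarith [ht.2]) ht.1.le (by ring)
  have h3 := hmin _ h1
  have e1 : (1 - t) • p + t • q - z = (p - z) + t • (q - p) := by module
  rw [e1, sqNorm_add hS, sqNorm_smul, bil_smul_right] at h3
  simp only [smul_eq_mul] at h2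
  have h4 : t * (φ p - φ q - t * (1 / 2 * sqNorm S (q - p))) ≤ t * bil S (p - z) (q - p) := by
    nlinarith
  exact le_of_mul_le_mul_left h4 ht.1

end ConvexAnalysis

/-! ### Primal iterates as minimizers of tilted strongly convex functions -/

section Iterates

variable {d : ℕ} {g h : EuclideanSpace ℝ (Fin d) → EReal}

/-- Real-valued version of `h + k γ g` on `dom h ∩ dom g`. -/
def hRegReal (h g : EuclideanSpace ℝ (Fin d) → EReal) (γ : ℝ) (k : ℕ)
    (v : EuclideanSpace ℝ (Fin d)) : ℝ :=
  finPart h v + k * γ * finPart g v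

lemma lowerSemicontinuous_const_mul (hg : LowerSemicontinuous g) {c : ℝ} (hc : 0 < c) :
    LowerSemicontinuous fun v => (c : EReal) * g v := by
  refine Continuous.comp_lowerSemicontinuous (g := fun t : EReal => (c : EReal) * t) ?_ hg ?_
  · rw [continuous_iff_continuousAt]
    intro t
    have hc' : (c : EReal) ≠ 0 := by exact_mod_cast hc.ne'
    exact EReal.Tendsto.const_mul tendsto_id (Or.inl (EReal.coe_ne_bot _))
      (Or.inl (EReal.coe_ne_top _))
  · exact fun a b hab => mul_le_mul_of_nonneg_left hab (by exact_mod_cast hc.le)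

variable {γ : ℝ}

/-- The shift to `k + 1` makes the coefficient of `g` positive; at index `0` the convention `0 * ∞ =
0` would leave all of `dom h`. -/
lemma effDom_hReg_succ (hg : IsProperLscConvex g) (hh : IsLegendre h) (hγ : 0 < γ)
    (k : ℕ) : effDom (hReg h g γ (k + 1)) = effDom h ∩ effDom g := by
  have hc : (0 : ℝ) < ((k + 1 : ℕ) : ℝ) * γ := by positivity
  ext v
  simp only [effDom, hReg, Set.mem_ofPred_eq, Set.mem_inter_iff]
  constructor
  · intro hv
    have hcg : (((((k + 1 : ℕ) : ℝ) * γ : ℝ)) : EReal) * g v ≠ ⊥ := by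
      rcases eq_or_ne (g v) ⊤ with h1 | h1
      · rw [h1, EReal.coe_mul_top_of_pos hc]; simp
      · rw [← EReal.coe_toReal h1 (hg.proper.1 v), ← EReal.coe_mul]; exact EReal.coe_ne_bot _
    constructor
    · by_contra hcon
      rw [not_lt_top_iff] at hcon
      rw [hcon, EReal.top_add_of_ne_bot hcg] at hv
      exact lt_irrefl _ hv
    · by_contra hcon
      rw [not_lt_top_iff] at hcon
      rw [hcon, EReal.coe_mul_top_of_pos hc, EReal.add_top_of_ne_bot (hh.proper.1 v)] at hv
      exact lt_irrefl _ hv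
  · rintro ⟨h1, h2⟩
    refine EReal.add_lt_top h1.ne ?_
    rw [← EReal.coe_toReal h2.ne (hg.proper.1 v), ← EReal.coe_mul]
    exact EReal.coe_ne_top _

lemma hReg_eq_coe (hg : IsProperLscConvex g) (hh : IsLegendre h)
    (k : ℕ) {v : EuclideanSpace ℝ (Fin d)} (hv : v ∈ effDom h ∩ effDom g) :
    hReg h g γ k v = ((hRegReal h g γ k v : ℝ) : EReal) := by
  rw [hReg, hRegReal, EReal.coe_add, EReal.coe_mul _ (finPart g v), coe_finPart hh.proper.1 hv.1,
    coe_finPart hg.proper.1 hv.2]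

lemma finPart_hReg (hg : IsProperLscConvex g) (hh : IsLegendre h)
    (k : ℕ) {v : EuclideanSpace ℝ (Fin d)} (hv : v ∈ effDom h ∩ effDom g) :
    finPart (hReg h g γ k) v = hRegReal h g γ k v := by
  rw [finPart, hReg_eq_coe hg hh k hv, EReal.toReal_coe]

lemma lowerSemicontinuous_hReg_succ (hg : IsProperLscConvex g) (hh : IsLegendre h) (hγ : 0 < γ)
    (hgnonneg : ∀ v, 0 ≤ g v) (k : ℕ) :
    LowerSemicontinuous (hReg h g γ (k + 1)) := by
  have hc : (0 : ℝ) < ((k + 1 : ℕ) : ℝ) * γ := by positivity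
  refine hh.lsc.add' (lowerSemicontinuous_const_mul hg.lsc hc) fun v => ?_
  have h1 : (((((k + 1 : ℕ) : ℝ) * γ : ℝ)) : EReal) * g v ≠ ⊥ := by
    have : (0 : EReal) ≤ (((((k + 1 : ℕ) : ℝ) * γ : ℝ)) : EReal) * g v :=
      EReal.mul_nonneg (by exact_mod_cast hc.le) (hgnonneg v)
    intro h0
    rw [h0] at this
    exact absurd this (by simp)
  exact EReal.continuousAt_add (Or.inr h1) (Or.inl (hh.proper.1 v))

lemma convexOn_hRegReal_sub (hg : IsProperLscConvex g) (hγ : 0 < γ)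
    {M : Matrix (Fin d) (Fin d) ℝ} {μ : ℝ}
    (hconv : ConvexOn ℝ (effDom h) fun v => finPart h v - μ / 2 * sqNorm M v) (k : ℕ) :
    ConvexOn ℝ (effDom h ∩ effDom g) fun v => hRegReal h g γ k v - μ / 2 * sqNorm M v := by
  have hD : Convex ℝ (effDom h ∩ effDom g) := hconv.1.inter hg.convex.1
  have h1 := (hconv.subset Set.inter_subset_left hD).add
    ((hg.convex.subset Set.inter_subset_right hD).smul (show 0 ≤ (k : ℝ) * γ by positivity))
  refine h1.congr fun v _ => ?_
  simp only [Pi.add_apply, smul_eq_mul, hRegReal]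
  ring

variable {Ω : Type*} {θ₀ : EuclideanSpace ℝ (Fin d)}
  {x : ℕ → Ω → EuclideanSpace ℝ (Fin d)} {y : ℕ → Ω → ℝ}
  {η θ : ℕ → Ω → EuclideanSpace ℝ (Fin d)}

/-- The dual iterate `η_k` is a (strong) subgradient of `h + k γ g` at the primal iterate `θ_k`. -/
theorem IsSDA.strong_subgradient (hg : IsProperLscConvex g) (hh : IsLegendre h) (hγ : 0 < γ)
    (hgnonneg : ∀ v, 0 ≤ g v) {M N : Matrix (Fin d) (Fin d) ℝ}
    (hM : M.PosSemidef) (hN : N.IsHermitian) (hMN : M * N = 1) {μ : ℝ} (hμ : 0 < μ)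
    (hconv : ConvexOn ℝ (effDom h) fun v => finPart h v - μ / 2 * sqNorm M v)
    (hθ₀ : θ₀ ∈ interior (effDom h)) (hgθ₀ : θ₀ ∈ effDom g)
    (hsda : IsSDA h g γ θ₀ x y η θ) (k : ℕ) (ω : Ω) :
    θ k ω ∈ effDom h ∩ effDom g ∧ ∀ q ∈ effDom h ∩ effDom g,
      hRegReal h g γ k (θ k ω) + ⟪η k ω, q - θ k ω⟫_ℝ + μ / 2 * sqNorm M (q - θ k ω)
        ≤ hRegReal h g γ k q := by
  have hθ₀D : θ₀ ∈ effDom h ∩ effDom g := ⟨interior_subset hθ₀, hgθ₀⟩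
  have hgrad : ∀ q ∈ effDom h,
      finPart h θ₀ + ⟪gradient (finPart h) θ₀, q - θ₀⟫_ℝ ≤ finPart h q := fun q hq =>
    add_inner_gradient_le hh.strictConvex.convexOn hθ₀D.1 (hh.differentiable _ hθ₀) hq
  -- A plain subgradient inequality is enough, since convexity of `h + kγg` minus the quadratic form
  -- upgrades it.
  suffices hmin : θ k ω ∈ effDom h ∩ effDom g ∧ ∀ q ∈ effDom h ∩ effDom g,
      hRegReal h g γ k (θ k ω) + ⟪η k ω, q - θ k ω⟫_ℝ ≤ hRegReal h g γ k q from
    ⟨hmin.1, fun q hq =>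
      add_sqNorm_le_of_isMin hM.1 (convexOn_hRegReal_sub hg hγ hconv k) hmin.1 hmin.2 hq⟩
  cases k with
  | zero =>
    rw [hsda.primal_zero, hsda.dual_zero]
    refine ⟨hθ₀D, fun q hq => ?_⟩
    simpa [hRegReal] using hgrad q hq.1
  | succ k =>
    have hdom := effDom_hReg_succ hg hh hγ k
    obtain ⟨c, hc, hcM⟩ := exists_mul_norm_sq_le_sqNorm hM hN hMN
    -- Quadratic growth of `h` around `θ₀` survives adding a multiple of `g ≥ 0`. It yields a
    -- minimizer of the tilted function, which the conjugate gradient must then equal.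
    have hbase : ∀ q ∈ effDom h ∩ effDom g,
        finPart h θ₀ + ⟪gradient (finPart h) θ₀, q - θ₀⟫_ℝ + (μ / 2 * c) * ‖q - θ₀‖ ^ 2
          ≤ hRegReal h g γ (k + 1) q := by
      intro q hq
      have h1 := add_sqNorm_le_of_isMin hM.1 hconv hθ₀D.1 hgrad hq.1
      have h2 : 0 ≤ finPart g q := EReal.toReal_nonneg (hgnonneg q)
      have h3 : 0 ≤ ((k + 1 : ℕ) : ℝ) * γ * finPart g q := by positivity
      have h4 := mul_le_mul_of_nonneg_left (hcM (q - θ₀)) (half_pos hμ).le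
      rw [hRegReal]
      linarith
    obtain ⟨p, hp, hpmin⟩ := exists_isMin_of_growth (F := hReg h g γ (k + 1))
      (lowerSemicontinuous_hReg_succ hg hh hγ hgnonneg k) (show 0 < μ / 2 * c by positivity)
      (p₀ := θ₀) (w := gradient (finPart h) θ₀) (a := finPart h θ₀) (by rw [hdom]; exact hθ₀D)
      (fun q => by
        by_cases hq : q ∈ effDom h ∩ effDom g
        · rw [hReg_eq_coe hg hh _ hq]
          exact_mod_cast hbase q hq
        · rw [← hdom] at hq
          have : hReg h g γ (k + 1) q = ⊤ := by simpa [effDom] using hq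
          rw [this]; exact le_top) (η (k + 1) ω)
    have hbot : ∀ q, hReg h g γ (k + 1) q ≠ ⊥ := by
      intro q
      by_cases hq : q ∈ effDom h ∩ effDom g
      · rw [hReg_eq_coe hg hh _ hq]; exact EReal.coe_ne_bot _
      · rw [← hdom] at hq
        have : hReg h g γ (k + 1) q = ⊤ := by simpa [effDom] using hq
        rw [this]; simp
    have heq := (hsda.primal_succ k ω).eq_of_isMin hbot hp hpmin
    rw [heq]
    rw [hdom] at hp hpmin
    refine ⟨hp, fun q hq => ?_⟩
    have := hpmin q hq
    rwa [finPart_hReg hg hh _ hp, finPart_hReg hg hh _ hq] at this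

end Iterates

/-! ### Deterministic inequalities along a trajectory -/

section Pathwise

variable {d : ℕ} {g h : EuclideanSpace ℝ (Fin d) → EReal} {D : Set (EuclideanSpace ℝ (Fin d))}
  {S M N : Matrix (Fin d) (Fin d) ℝ} {γ μ : ℝ} {t e v : ℕ → EuclideanSpace ℝ (Fin d)}
  {p z : EuclideanSpace ℝ (Fin d)}

/-- Centered gradient noise at the iterates. -/
def noise (S : Matrix (Fin d) (Fin d) ℝ) (z : EuclideanSpace ℝ (Fin d))
    (t v : ℕ → EuclideanSpace ℝ (Fin d)) (k : ℕ) : EuclideanSpace ℝ (Fin d) :=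
  v k + act S (t k - z)

/-- Recentered sum of the iterates, from which the preconditioned noise has been removed. -/
noncomputable def denoisedSum (S : Matrix (Fin d) (Fin d) ℝ) (p z : EuclideanSpace ℝ (Fin d))
    (t v : ℕ → EuclideanSpace ℝ (Fin d)) (k : ℕ) : EuclideanSpace ℝ (Fin d) :=
  ∑ j ∈ Finset.range k, (t j - p - act S⁻¹ (noise S z t v j))

/-- Pathwise energy inequality of dual averaging. -/
theorem energy_inequality (hM : M.PosSemidef) (hN : N.IsHermitian) (hMN : M * N = 1)
    (hS : S.IsHermitian) (hγ : 0 < γ) (hμ : 0 < μ) (hgnonneg : ∀ q, 0 ≤ g q) (hp : p ∈ D)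
    (hsub : ∀ k, t k ∈ D ∧ ∀ q ∈ D, hRegReal h g γ k (t k) + ⟪e k, q - t k⟫_ℝ
      + μ / 2 * sqNorm M (q - t k) ≤ hRegReal h g γ k q)
    (hdual : ∀ k, e (k + 1) = e k + γ • v k)
    (hopt : ∀ q ∈ D, finPart g p - finPart g q ≤ bil S (p - z) (q - p)) (n : ℕ) :
    γ * ∑ k ∈ Finset.range n, sqNorm S (t k - p)
      ≤ (finPart h p - finPart h (t 0) - ⟪e 0, p - t 0⟫_ℝ) + γ * finPart g (t 0)
        + ∑ k ∈ Finset.range n,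
          (γ * ⟪noise S z t v k, t k - p⟫_ℝ + γ ^ 2 / (2 * μ) * sqNorm N (v k)) := by
  -- The induction carries the duality gap at `t n` plus `γ g(t n)`. The extra term offsets the
  -- index mismatch between the new regularizer, seen at `t (k + 1)`, and optimality, tested at `t
  -- k`; its initial value is the source of the `g(θ₀)` term.
  have key : (hRegReal h g γ n p - hRegReal h g γ n (t n) - ⟪e n, p - t n⟫_ℝ)
      + γ * finPart g (t n) + γ * ∑ k ∈ Finset.range n, sqNorm S (t k - p)
      ≤ (finPart h p - finPart h (t 0) - ⟪e 0, p - t 0⟫_ℝ) + γ * finPart g (t 0)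
        + ∑ k ∈ Finset.range n,
          (γ * ⟪noise S z t v k, t k - p⟫_ℝ + γ ^ 2 / (2 * μ) * sqNorm N (v k)) := by
    induction n with
    | zero => simp [hRegReal]
    | succ k ih =>
      rw [Finset.sum_range_succ, Finset.sum_range_succ]
      have h1 := (hsub k).2 _ (hsub (k + 1)).1
      have h2 := mul_le_mul_of_nonneg_left (hopt _ (hsub k).1) hγ.le
      -- Weight `μ` makes the primal term match the strong convexity gain in `h1`.
      have h3 := inner_le_young hM hN hMN hμ (γ • v k) (t (k + 1) - t k)
      have e1 : ⟪γ • v k, t (k + 1) - t k⟫_ℝ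
          = ⟪γ • v k, t (k + 1)⟫_ℝ - ⟪γ • v k, t k⟫_ℝ := inner_sub_right _ _ _
      have e2 : ⟪noise S z t v k, t k - p⟫_ℝ
          = ⟪v k, t k⟫_ℝ - ⟪v k, p⟫_ℝ + (sqNorm S (t k - p) + bil S (p - z) (t k - p)) := by
        rw [noise, inner_add_left, inner_sub_right, real_inner_comm (t k - p) (act S (t k - z)),
          inner_act_right, show t k - z = (t k - p) + (p - z) by abel, bil_add_right,
          bil_comm hS _ (p - z)]
        rfl
      rw [sqNorm_smul] at h3
      rw [e1] at h3
      rw [e2, hdual]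
      simp only [hRegReal, inner_add_left, inner_sub_right, real_inner_smul_left] at *
      push_cast
      have e3 : 1 / (2 * μ) * (γ ^ 2 * sqNorm N (v k)) = γ ^ 2 / (2 * μ) * sqNorm N (v k) := by
        ring
      rw [e3] at h3
      linarith
  -- The final gap and the final `γ g(t n)` are nonnegative and can be dropped.
  have h1 := (hsub n).2 p hp
  have h2 := mul_nonneg (half_pos hμ).le (sqNorm_nonneg hM (p - t n))
  have h3 : 0 ≤ γ * finPart g (t n) := mul_nonneg hγ.le (EReal.toReal_nonneg (hgnonneg _))
  linarith

/-- Pathwise control of the denoised sum. -/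
theorem sqNorm_denoisedSum_le (hM : M.PosSemidef) (hS : S.PosDef) (hγ : 0 < γ) (hμ : 0 < μ)
    (hp : p ∈ D)
    (hsub : ∀ k, t k ∈ D ∧ ∀ q ∈ D, hRegReal h g γ k (t k) + ⟪e k, q - t k⟫_ℝ
      + μ / 2 * sqNorm M (q - t k) ≤ hRegReal h g γ k q)
    (hdual : ∀ k, e (k + 1) = e k + γ • v k)
    (hopt : ∀ q ∈ D, finPart g p - finPart g q ≤ bil S (p - z) (q - p)) (n : ℕ) :
    sqNorm S (denoisedSum S p z t v n)
      ≤ n * (2 / γ * (finPart h p - finPart h (t 0) - ⟪e 0, p - t 0⟫_ℝ))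
        + ∑ k ∈ Finset.range n, (sqNorm S (t k - p - act S⁻¹ (noise S z t v k))
            - 2 * ⟪noise S z t v k, denoisedSum S p z t v k⟫_ℝ) := by
  have hSS : S * S⁻¹ = 1 := Matrix.mul_nonsing_inv _ hS.det_pos.ne'.isUnit
  have hsucc : ∀ k, denoisedSum S p z t v (k + 1)
      = denoisedSum S p z t v k + (t k - p - act S⁻¹ (noise S z t v k)) := fun k => by
    rw [denoisedSum, Finset.sum_range_succ]; rfl
  have hbilnoise : ∀ k u, bil S u (act S⁻¹ (noise S z t v k)) = ⟪noise S z t v k, u⟫_ℝ := by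
    intro k u
    rw [bil_act_right, hSS, bil_one, real_inner_comm]
  -- Writing `v j` as the noise minus `S (t j - p)` minus `S (p - z)` and summing the dual recursion
  -- expresses `e k` through the denoised sum.
  have hlin : ∀ k u, γ * bil S (denoisedSum S p z t v k) u
      = ⟪e 0 - e k, u⟫_ℝ + k * γ * bil S (z - p) u := by
    intro k u
    induction k with
    | zero => simp [denoisedSum, bil]
    | succ k ih =>
      rw [hsucc, bil_add_left, mul_add, ih, bil_sub_left _ (t k - p), bil_comm hS.1 (act _ _),
        hbilnoise, hdual, noise, inner_add_left, real_inner_comm u (act S (t k - z)), inner_act_right,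
        bil_comm hS.1 u]
      simp only [inner_sub_left, inner_add_left, real_inner_smul_left, bil_sub_left]
      push_cast
      ring
  -- Add the subgradient inequality at `t k` tested at `p` to the one at `t 0` tested at `t k`. The
  -- growing terms `kγ(g(p) - g(t k))` are cancelled by optimality of `p`, so the bound does not
  -- depend on `k`.
  have hkey : ∀ k, γ * bil S (denoisedSum S p z t v k) (t k - p)
      ≤ finPart h p - finPart h (t 0) - ⟪e 0, p - t 0⟫_ℝ := by
    intro k
    have h1 := (hsub k).2 p hp
    have h2 := (hsub 0).2 _ (hsub k).1
    have h3 := mul_le_mul_of_nonneg_left (hopt _ (hsub k).1) (show 0 ≤ k * γ by positivity)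
    have h4 := mul_nonneg (half_pos hμ).le (sqNorm_nonneg hM (p - t k))
    have h5 := mul_nonneg (half_pos hμ).le (sqNorm_nonneg hM (t k - t 0))
    rw [hlin]
    simp only [hRegReal, Nat.cast_zero, zero_mul, add_zero, inner_sub_left, inner_sub_right,
      bil_sub_left] at *
    linarith
  induction n with
  | zero => simp [denoisedSum, sqNorm]
  | succ k ih =>
    rw [Finset.sum_range_succ, hsucc, sqNorm_add hS.1, bil_sub_right, hbilnoise]
    have h1 : bil S (denoisedSum S p z t v k) (t k - p)
        ≤ 1 / γ * (finPart h p - finPart h (t 0) - ⟪e 0, p - t 0⟫_ℝ) := by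
      rw [one_div, ← div_eq_inv_mul, le_div_iff₀ hγ, mul_comm]
      exact hkey k
    push_cast
    have e1 : 2 / γ * (finPart h p - finPart h (t 0) - ⟪e 0, p - t 0⟫_ℝ)
      = 2 * (1 / γ * (finPart h p - finPart h (t 0) - ⟪e 0, p - t 0⟫_ℝ)) := by ring
    linarith

/-- The sum of the centered iterates is the denoised sum plus the preconditioned noise. -/
lemma half_sqNorm_sum_le (hS : S.PosDef) (n : ℕ) :
    1 / 2 * sqNorm S (∑ k ∈ Finset.range n, (t k - p))
      ≤ sqNorm S (denoisedSum S p z t v n)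
        + sqNorm S (∑ k ∈ Finset.range n, act S⁻¹ (noise S z t v k)) := by
  have h1 : ∑ k ∈ Finset.range n, (t k - p) = denoisedSum S p z t v n
      + ∑ k ∈ Finset.range n, act S⁻¹ (noise S z t v k) := by
    rw [denoisedSum, Finset.sum_sub_distrib _ fun k => act S⁻¹ (noise S z t v k)]; abel
  rw [h1]
  linarith [sqNorm_add_le hS.posSemidef (denoisedSum S p z t v n)
    (∑ k ∈ Finset.range n, act S⁻¹ (noise S z t v k))]

end Pathwise

/-! ### Second moments of random vectors -/

section SecondMoments

variable {Ω : Type*} [mΩ : MeasurableSpace Ω] {P : Measure Ω} {d : ℕ}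

lemma memLp_coord {X : Ω → EuclideanSpace ℝ (Fin d)} (hX : MemLp X 2 P) (i : Fin d) :
    MemLp (fun ω => X ω i) 2 P :=
  (EuclideanSpace.proj (𝕜 := ℝ) i).comp_memLp' hX

lemma memLp_act (A : Matrix (Fin d) (Fin d) ℝ) {X : Ω → EuclideanSpace ℝ (Fin d)}
    (hX : MemLp X 2 P) : MemLp (fun ω => act A (X ω)) 2 P := by
  simp only [act_eq_toEuclideanCLM]
  exact (Matrix.toEuclideanCLM (𝕜 := ℝ) A).comp_memLp' hX

lemma integrable_inner_of_memLp {X Y : Ω → EuclideanSpace ℝ (Fin d)} (hX : MemLp X 2 P)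
    (hY : MemLp Y 2 P) : Integrable (fun ω => ⟪X ω, Y ω⟫_ℝ) P := by
  refine Integrable.mono' (hX.norm.integrable_mul hY.norm) (hX.1.inner hY.1)
    (Eventually.of_forall fun ω => ?_)
  exact norm_inner_le_norm _ _

lemma integrable_bil (A : Matrix (Fin d) (Fin d) ℝ) {X Y : Ω → EuclideanSpace ℝ (Fin d)}
    (hX : MemLp X 2 P) (hY : MemLp Y 2 P) : Integrable (fun ω => bil A (X ω) (Y ω)) P := by
  simp only [← inner_act_right]
  exact integrable_inner_of_memLp hX (memLp_act A hY)

lemma integrable_sqNorm (A : Matrix (Fin d) (Fin d) ℝ) {X : Ω → EuclideanSpace ℝ (Fin d)}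
    (hX : MemLp X 2 P) : Integrable (fun ω => sqNorm A (X ω)) P :=
  integrable_bil A hX hX

lemma integral_bil (A : Matrix (Fin d) (Fin d) ℝ) {X Y : Ω → EuclideanSpace ℝ (Fin d)}
    (hX : MemLp X 2 P) (hY : MemLp Y 2 P) :
    ∫ ω, bil A (X ω) (Y ω) ∂P = ∑ i, ∑ j, A i j * ∫ ω, X ω i * Y ω j ∂P := by
  simp only [bil_eq_sum]
  have hint : ∀ i j, Integrable (fun ω => A i j * (X ω i * Y ω j)) P := fun i j =>
    ((memLp_coord hX i).integrable_mul (memLp_coord hY j)).const_mul _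
  rw [integral_finsetSum _ fun i _ => integrable_finsetSum _ fun j _ => hint i j]
  refine Finset.sum_congr rfl fun i _ => ?_
  rw [integral_finsetSum _ fun j _ => hint i j]
  exact Finset.sum_congr rfl fun j _ => integral_const_mul _ _

lemma integral_sqNorm_eq_trace (A : Matrix (Fin d) (Fin d) ℝ) {X : Ω → EuclideanSpace ℝ (Fin d)}
    (hX : MemLp X 2 P) : ∫ ω, sqNorm A (X ω) ∂P = (secondMoment P X * A).trace := by
  simp only [sqNorm_eq_bil]
  rw [integral_bil A hX hX, Matrix.trace, Finset.sum_comm]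
  simp only [Matrix.diag, Matrix.mul_apply, secondMoment, Matrix.of_apply]
  refine Finset.sum_congr rfl fun i _ => Finset.sum_congr rfl fun j _ => ?_
  rw [mul_comm]
  congr 2
  funext ω
  ring

lemma integral_inner_sq {X : Ω → EuclideanSpace ℝ (Fin d)} (hX : MemLp X 2 P)
    (w : EuclideanSpace ℝ (Fin d)) :
    ∫ ω, ⟪w, X ω⟫_ℝ ^ 2 ∂P = sqNorm (secondMoment P X) w := by
  have hpt : ∀ ω, ⟪w, X ω⟫_ℝ ^ 2 = ∑ i, ∑ j, (X ω i * X ω j) * (w i * w j) := by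
    intro ω
    rw [inner_eq_dotProduct, sq]
    simp only [dotProduct]
    rw [Finset.sum_mul_sum]
    exact Finset.sum_congr rfl fun i _ => Finset.sum_congr rfl fun j _ => by ring
  have hint : ∀ i j, Integrable (fun ω => (X ω i * X ω j) * (w i * w j)) P := fun i j =>
    ((memLp_coord hX i).integrable_mul (memLp_coord hX j)).mul_const _
  simp only [hpt]
  rw [integral_finsetSum _ fun i _ => integrable_finsetSum _ fun j _ => hint i j,
    sqNorm_eq_bil, bil_eq_sum]
  refine Finset.sum_congr rfl fun i _ => ?_
  rw [integral_finsetSum _ fun j _ => hint i j]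
  exact Finset.sum_congr rfl fun j _ => integral_mul_const _ _

lemma integrable_mul_of_indep {ℱ 𝒢 : MeasurableSpace Ω} (hind : Indep ℱ 𝒢 P) {z a : Ω → ℝ}
    (hz : Measurable[ℱ] z) (ha : Measurable[𝒢] a) (iz : Integrable z P) (ia : Integrable a P) :
    Integrable (fun ω => a ω * z ω) P ∧ ∫ ω, a ω * z ω ∂P = (∫ ω, a ω ∂P) * ∫ ω, z ω ∂P := by
  have hI : IndepFun a z P := by
    rw [IndepFun_iff_Indep]
    exact (indep_of_indep_of_le hind hz.comap_le ha.comap_le).symm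
  exact ⟨hI.integrable_mul ia iz, hI.integral_mul_eq_mul_integral ia.1 iz.1⟩

end SecondMoments

/-! ### Moments of one observation, independent of the past -/

section Sample

variable {Ω : Type*} {d : ℕ}

/-- A least-squares observation, measurable with respect to `𝒢`, with second moment matrix `S`,
noise covariance `C` at the population minimizer `θS` and kurtosis bounded by `κ`. -/
structure IsSample (𝒢 : MeasurableSpace Ω) [mΩ : MeasurableSpace Ω] (P : Measure Ω)
    (S C : Matrix (Fin d) (Fin d) ℝ) (κ : ℝ) (θS : EuclideanSpace ℝ (Fin d))
    (x : Ω → EuclideanSpace ℝ (Fin d)) (y : Ω → ℝ) : Prop where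
  measurable_x : Measurable[𝒢] x
  measurable_y : Measurable[𝒢] y
  memLp_x : MemLp x 2 P
  integrable_norm_pow_four : Integrable (fun ω => ‖x ω‖ ^ 4) P
  secondMoment_x : secondMoment P x = S
  integral_inner_pow_four_le : ∀ z, ∫ ω, ⟪z, x ω⟫_ℝ ^ 4 ∂P ≤ κ * sqNorm S z ^ 2
  memLp_residual : MemLp (residual x y θS) 2 P
  integral_residual : ∀ i, ∫ ω, residual x y θS ω i ∂P = 0
  secondMoment_residual : secondMoment P (residual x y θS) = C

variable {ℱ 𝒢 : MeasurableSpace Ω} [mΩ : MeasurableSpace Ω] {P : Measure Ω}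
  {S C M : Matrix (Fin d) (Fin d) ℝ} {κ : ℝ} {θS : EuclideanSpace ℝ (Fin d)}
  {x : Ω → EuclideanSpace ℝ (Fin d)} {y : Ω → ℝ}

lemma IsSample.integrable_inner_pow_four (hs : IsSample 𝒢 P S C κ θS x y)
    (z : EuclideanSpace ℝ (Fin d)) : Integrable (fun ω => ⟪z, x ω⟫_ℝ ^ 4) P := by
  refine Integrable.mono' (hs.integrable_norm_pow_four.const_mul (‖z‖ ^ 4))
    ((aestronglyMeasurable_const.inner hs.memLp_x.1).pow 4) (Eventually.of_forall fun ω => ?_)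
  rw [norm_pow, ← mul_pow]
  exact pow_le_pow_left₀ (norm_nonneg _) (norm_inner_le_norm _ _) 4

lemma integrable_sq_mul_sq {f k : Ω → ℝ} (hf : AEStronglyMeasurable f P)
    (hk : AEStronglyMeasurable k P) (hf4 : Integrable (fun ω => f ω ^ 4) P)
    (hk4 : Integrable (fun ω => k ω ^ 4) P) : Integrable (fun ω => f ω ^ 2 * k ω ^ 2) P := by
  refine Integrable.mono' (hf4.add hk4) ((hf.pow 2).mul (hk.pow 2))
    (Eventually.of_forall fun ω => ?_)
  rw [Real.norm_of_nonneg (by positivity)]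
  simp only [Pi.add_apply]
  nlinarith [sq_nonneg (f ω ^ 2 - k ω ^ 2), sq_nonneg (f ω ^ 2), sq_nonneg (k ω ^ 2)]

/-- Pointwise weighted AM-GM replaces Cauchy–Schwarz: the weights `b / (2a)` and `a / (2b)` balance
the two fourth-moment bounds. Zero vectors are set apart because the weights divide by their norms.
-/
lemma IsSample.integral_sq_mul_sq_le (hs : IsSample 𝒢 P S C κ θS x y) (hS : S.PosDef)
    (u w : EuclideanSpace ℝ (Fin d)) :
    ∫ ω, ⟪u, x ω⟫_ℝ ^ 2 * ⟪w, x ω⟫_ℝ ^ 2 ∂P ≤ κ * (sqNorm S u * sqNorm S w) := by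
  by_cases hu : u = 0
  · simp [hu, sqNorm]
  by_cases hw : w = 0
  · simp [hw, sqNorm]
  have hu' := sqNorm_pos hS hu
  have hw' := sqNorm_pos hS hw
  set a := sqNorm S u
  set b := sqNorm S w
  have i1 := hs.integrable_inner_pow_four u
  have i2 := hs.integrable_inner_pow_four w
  have i3 := integrable_sq_mul_sq (aestronglyMeasurable_const.inner hs.memLp_x.1)
    (aestronglyMeasurable_const.inner hs.memLp_x.1) i1 i2
  have h1 : ∫ ω, ⟪u, x ω⟫_ℝ ^ 2 * ⟪w, x ω⟫_ℝ ^ 2 ∂P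
      ≤ ∫ ω, (b / (2 * a) * ⟪u, x ω⟫_ℝ ^ 4 + a / (2 * b) * ⟪w, x ω⟫_ℝ ^ 4) ∂P := by
    refine integral_mono i3 ((i1.const_mul _).add (i2.const_mul _)) fun ω => ?_
    set f := ⟪u, x ω⟫_ℝ
    set k := ⟪w, x ω⟫_ℝ
    have : b / (2 * a) * f ^ 4 + a / (2 * b) * k ^ 4 - f ^ 2 * k ^ 2
        = (b * f ^ 2 - a * k ^ 2) ^ 2 / (2 * a * b) := by field_simp; ring
    have h2 : 0 ≤ (b * f ^ 2 - a * k ^ 2) ^ 2 / (2 * a * b) := by positivity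
    change f ^ 2 * k ^ 2 ≤ b / (2 * a) * f ^ 4 + a / (2 * b) * k ^ 4
    linarith
  rw [integral_add (i1.const_mul _) (i2.const_mul _), integral_const_mul, integral_const_mul] at h1
  have h2 := mul_le_mul_of_nonneg_left (hs.integral_inner_pow_four_le u)
    (show 0 ≤ b / (2 * a) by positivity)
  have h3 := mul_le_mul_of_nonneg_left (hs.integral_inner_pow_four_le w)
    (show 0 ≤ a / (2 * b) by positivity)
  have h4 : b / (2 * a) * (κ * a ^ 2) + a / (2 * b) * (κ * b ^ 2) = κ * (a * b) := by
    field_simp; ring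
  change _ ≤ b / (2 * a) * (κ * a ^ 2) at h2
  change _ ≤ a / (2 * b) * (κ * b ^ 2) at h3
  linarith

/-- Split the form of `M` into squares of linear forms and bound each product of two squares; the
resulting norms add up to the trace. -/
lemma IsSample.integral_sqNorm_mul_sq_le (hs : IsSample 𝒢 P S C κ θS x y) (hS : S.PosDef)
    (hM : M.PosSemidef) (w : EuclideanSpace ℝ (Fin d)) :
    ∫ ω, sqNorm M (x ω) * ⟪w, x ω⟫_ℝ ^ 2 ∂P ≤ κ * (M * S).trace * sqNorm S w := by
  obtain ⟨r, hr, htr⟩ := exists_sum_sq hM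
  have hi : ∀ j, Integrable (fun ω => ⟪r j, x ω⟫_ℝ ^ 2 * ⟪w, x ω⟫_ℝ ^ 2) P := fun j =>
    integrable_sq_mul_sq (aestronglyMeasurable_const.inner hs.memLp_x.1)
      (aestronglyMeasurable_const.inner hs.memLp_x.1) (hs.integrable_inner_pow_four _)
      (hs.integrable_inner_pow_four _)
  simp only [hr, Finset.sum_mul, htr]
  rw [integral_finsetSum _ fun j _ => hi j, Finset.mul_sum, Finset.sum_mul]
  refine Finset.sum_le_sum fun j _ => (hs.integral_sq_mul_sq_le hS (r j) w).trans (le_of_eq ?_)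
  ring

lemma measurable_coord {Ω : Type*} {ℱ : MeasurableSpace Ω} {X : Ω → EuclideanSpace ℝ (Fin d)} (hX : Measurable[ℱ] X) (i : Fin d) :
    Measurable[ℱ] fun ω => X ω i :=
  (EuclideanSpace.proj (𝕜 := ℝ) i).continuous.measurable.comp hX

/-- Expectation of a quadratic form whose random coefficients are independent of its random
arguments. -/
lemma integral_sum_mul_of_indep (hind : Indep ℱ 𝒢 P) {A : Ω → Fin d → Fin d → ℝ}
    (hA : ∀ i j, Measurable[𝒢] fun ω => A ω i j) (iA : ∀ i j, Integrable (fun ω => A ω i j) P)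
    {X Y : Ω → EuclideanSpace ℝ (Fin d)} (hX : Measurable[ℱ] X) (hY : Measurable[ℱ] Y)
    (hX2 : MemLp X 2 P) (hY2 : MemLp Y 2 P) :
    Integrable (fun ω => ∑ i, ∑ j, A ω i j * (X ω i * Y ω j)) P ∧
      ∫ ω, ∑ i, ∑ j, A ω i j * (X ω i * Y ω j) ∂P
        = ∫ ω, ∑ i, ∑ j, (∫ ω', A ω' i j ∂P) * (X ω i * Y ω j) ∂P := by
  have hXY : ∀ i j, Measurable[ℱ] fun ω => X ω i * Y ω j := fun i j =>
    (measurable_coord hX i).mul (measurable_coord hY j)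
  have iXY : ∀ i j, Integrable (fun ω => X ω i * Y ω j) P := fun i j =>
    (memLp_coord hX2 i).integrable_mul (memLp_coord hY2 j)
  have key := fun i j => integrable_mul_of_indep hind (hXY i j) (hA i j) (iXY i j) (iA i j)
  refine ⟨integrable_finsetSum _ fun i _ => integrable_finsetSum _ fun j _ => (key i j).1, ?_⟩
  rw [integral_finsetSum _ fun i _ => integrable_finsetSum _ fun j _ => (key i j).1,
    integral_finsetSum _ fun i _ => integrable_finsetSum _ fun j _ => (iXY i j).const_mul _]
  refine Finset.sum_congr rfl fun i _ => ?_
  rw [integral_finsetSum _ fun j _ => (key i j).1,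
    integral_finsetSum _ fun j _ => (iXY i j).const_mul _]
  refine Finset.sum_congr rfl fun j _ => ?_
  rw [(key i j).2, integral_const_mul]

/-- Separates the factors depending on the observation from those depending on the past, so that
independence applies entry by entry. -/
lemma sqNorm_mul_inner_sq (a : ℝ) (u w : EuclideanSpace ℝ (Fin d)) :
    a * ⟪u, w⟫_ℝ ^ 2 = ∑ i, ∑ j, (a * (w i * w j)) * (u i * u j) := by
  rw [inner_eq_dotProduct, sq]
  simp only [dotProduct]
  rw [Finset.sum_mul_sum, Finset.mul_sum]
  refine Finset.sum_congr rfl fun i _ => ?_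
  rw [Finset.mul_sum]
  exact Finset.sum_congr rfl fun j _ => by ring

lemma abs_coord_le (v : EuclideanSpace ℝ (Fin d)) (i : Fin d) : |v i| ≤ ‖v‖ :=
  PiLp.norm_apply_le v i

/-- Multiplicative noise in a direction independent of the observation. -/
lemma IsSample.memLp_and_integral_le (hs : IsSample 𝒢 P S C κ θS x y) (hS : S.PosDef)
    (hind : Indep ℱ 𝒢 P) {e : Ω → EuclideanSpace ℝ (Fin d)} (he : Measurable[ℱ] e)
    (he2 : MemLp e 2 P) :
    MemLp (fun ω => ⟪x ω, e ω⟫_ℝ • x ω) 2 P ∧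
      ∀ M : Matrix (Fin d) (Fin d) ℝ, M.PosSemidef →
        ∫ ω, sqNorm M (⟪x ω, e ω⟫_ℝ • x ω) ∂P
          ≤ κ * (M * S).trace * ∫ ω, sqNorm S (e ω) ∂P := by
  have hint : ∀ M : Matrix (Fin d) (Fin d) ℝ, ∀ i j,
      Measurable[𝒢] (fun ω => sqNorm M (x ω) * (x ω i * x ω j)) ∧
      Integrable (fun ω => sqNorm M (x ω) * (x ω i * x ω j)) P := by
    intro M i j
    refine ⟨((continuous_sqNorm M).measurable.comp hs.measurable_x).mul
      ((measurable_coord hs.measurable_x i).mul (measurable_coord hs.measurable_x j)), ?_⟩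
    obtain ⟨K, hK, hKM⟩ := abs_bil_le M
    refine Integrable.mono' (hs.integrable_norm_pow_four.const_mul K)
      (((continuous_sqNorm M).comp_aestronglyMeasurable hs.memLp_x.1).mul
        ((memLp_coord hs.memLp_x i).1.mul (memLp_coord hs.memLp_x j).1))
      (Eventually.of_forall fun ω => ?_)
    rw [Real.norm_eq_abs, abs_mul, abs_mul]
    calc |sqNorm M (x ω)| * (|x ω i| * |x ω j|)
        ≤ (K * (‖x ω‖ * ‖x ω‖)) * (‖x ω‖ * ‖x ω‖) := by
          gcongr
          · exact hKM _ _
          · exact abs_coord_le _ _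
          · exact abs_coord_le _ _
      _ = K * ‖x ω‖ ^ 4 := by ring
  have hpt : ∀ (M : Matrix (Fin d) (Fin d) ℝ) (u w : EuclideanSpace ℝ (Fin d)),
      sqNorm M (⟪w, u⟫_ℝ • w) = ∑ i, ∑ j, (sqNorm M w * (w i * w j)) * (u i * u j) := by
    intro M u w
    rw [sqNorm_smul, mul_comm, real_inner_comm, sqNorm_mul_inner_sq]
  have key := fun M => integral_sum_mul_of_indep hind (fun i j => (hint M i j).1)
    (fun i j => (hint M i j).2) he he he2 he2
  refine ⟨?_, fun M hM => ?_⟩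
  · have hmeas : AEStronglyMeasurable (fun ω => ⟪x ω, e ω⟫_ℝ • x ω) P :=
      (hs.memLp_x.1.inner (𝕜 := ℝ) he2.1).smul hs.memLp_x.1
    -- Square-integrability is the case `M = 1` of the entrywise computation.
    rw [memLp_two_iff_integrable_sq_norm hmeas]
    refine ((key 1).1).congr (Eventually.of_forall fun ω => ?_)
    change ∑ i, ∑ j, _ = ‖⟪x ω, e ω⟫_ℝ • x ω‖ ^ 2
    rw [← hpt, sqNorm_eq_bil, bil_one, real_inner_self_eq_norm_sq]
  -- Averaging the coefficients first freezes the direction `e ω`, and the bound for a deterministic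
  -- direction applies.
  · have hM1 : ∀ ω, ∑ i, ∑ j, (∫ ω', sqNorm M (x ω') * (x ω' i * x ω' j) ∂P) * (e ω i * e ω j)
        = ∫ ω', sqNorm M (x ω') * ⟪e ω, x ω'⟫_ℝ ^ 2 ∂P := by
      intro ω
      simp only [sqNorm_mul_inner_sq]
      rw [integral_finsetSum _ fun i _ => integrable_finsetSum _ fun j _ =>
        (hint M i j).2.mul_const _]
      refine Finset.sum_congr rfl fun i _ => ?_
      rw [integral_finsetSum _ fun j _ => (hint M i j).2.mul_const _]
      exact Finset.sum_congr rfl fun j _ => (integral_mul_const _ _).symm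
    simp only [hpt]
    rw [(key M).2, ← integral_const_mul]
    refine integral_mono ?_ ((integrable_sqNorm S he2).const_mul _) fun ω => ?_
    · exact integrable_finsetSum _ fun i _ => integrable_finsetSum _ fun j _ =>
        ((memLp_coord he2 i).integrable_mul (memLp_coord he2 j)).const_mul _
    · change ∑ i, ∑ j, _ ≤ _
      rw [hM1]
      exact hs.integral_sqNorm_mul_sq_le hS hM _

lemma residual_eq_sub {Ω : Type*} {x : Ω → EuclideanSpace ℝ (Fin d)} {y : Ω → ℝ}
    {θS : EuclideanSpace ℝ (Fin d)} (θ : EuclideanSpace ℝ (Fin d)) (ω : Ω) :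
    residual x y θ ω = residual x y θS ω - ⟪x ω, θ - θS⟫_ℝ • x ω := by
  simp only [residual, inner_sub_right]; module

lemma IsSample.memLp_residual_of_indep (hs : IsSample 𝒢 P S C κ θS x y) (hS : S.PosDef)
    [IsFiniteMeasure P] (hind : Indep ℱ 𝒢 P) {θ : Ω → EuclideanSpace ℝ (Fin d)}
    (hθ : Measurable[ℱ] θ) (hθ2 : MemLp θ 2 P) :
    MemLp (fun ω => residual x y (θ ω) ω) 2 P := by
  have heq : (fun ω => residual x y (θ ω) ω)
      = fun ω => residual x y θS ω - ⟪x ω, θ ω - θS⟫_ℝ • x ω :=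
    funext fun ω => residual_eq_sub _ _
  rw [heq]
  exact hs.memLp_residual.sub (hs.memLp_and_integral_le hS hind (hθ.sub_const θS)
    (hθ2.sub (memLp_const θS))).1

/-- The centered gradient noise is orthogonal to everything that is independent of the
observation. -/
lemma IsSample.integral_inner_noise (hs : IsSample 𝒢 P S C κ θS x y)
    [IsFiniteMeasure P] (hind : Indep ℱ 𝒢 P) {θ a : Ω → EuclideanSpace ℝ (Fin d)}
    (hθ : Measurable[ℱ] θ) (hθ2 : MemLp θ 2 P) (ha : Measurable[ℱ] a) (ha2 : MemLp a 2 P) :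
    ∫ ω, ⟪residual x y (θ ω) ω + act S (θ ω - θS), a ω⟫_ℝ ∂P = 0 := by
  have he : Measurable[ℱ] fun ω => θ ω - θS := hθ.sub_const θS
  have he2 : MemLp (fun ω => θ ω - θS) 2 P := hθ2.sub (memLp_const θS)
  have hξ : Measurable[𝒢] (residual x y θS) := by
    refine Measurable.smul (hs.measurable_y.sub ?_) hs.measurable_x
    exact (continuous_id.inner continuous_const).measurable.comp hs.measurable_x
  have h1 := fun i => integrable_mul_of_indep hind (measurable_coord ha i)
    (measurable_coord hξ i) ((memLp_coord ha2 i).integrable (by norm_num))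
    ((memLp_coord hs.memLp_residual i).integrable (by norm_num))
  have h2 := integral_sum_mul_of_indep (A := fun ω i j => x ω i * x ω j) hind
    (fun i j => (measurable_coord hs.measurable_x i).mul (measurable_coord hs.measurable_x j))
    (fun i j => (memLp_coord hs.memLp_x i).integrable_mul (memLp_coord hs.memLp_x j))
    ha he ha2 he2
  have hSij : ∀ i j, ∫ ω, x ω i * x ω j ∂P = S i j := fun i j => by
    rw [← hs.secondMoment_x]; rfl
  -- The first sum is centered by the normal equations; the second and the `S` term cancel in
  -- expectation because the mean of `x ⊗ x` is `S`.
  have hpt : ∀ ω, ⟪residual x y (θ ω) ω + act S (θ ω - θS), a ω⟫_ℝ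
      = ∑ i, residual x y θS ω i * a ω i
        - ∑ i, ∑ j, (x ω i * x ω j) * (a ω i * (θ ω - θS) j) + bil S (a ω) (θ ω - θS) := by
    intro ω
    rw [inner_add_left, real_inner_comm (a ω) (act S _), inner_act_right,
      residual_eq_sub (θS := θS), inner_sub_left, real_inner_smul_left]
    congr 2
    · rw [inner_eq_dotProduct]; rfl
    · rw [inner_eq_dotProduct, inner_eq_dotProduct, mul_comm]
      simp only [dotProduct, Finset.sum_mul_sum]
      exact Finset.sum_congr rfl fun i _ => Finset.sum_congr rfl fun j _ => by ring
  simp only [hpt]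
  have i1 : Integrable (fun ω => ∑ i, residual x y θS ω i * a ω i) P :=
    integrable_finsetSum _ fun i _ => (h1 i).1
  rw [integral_add (f := fun ω => ∑ i, residual x y θS ω i * a ω i
      - ∑ i, ∑ j, (x ω i * x ω j) * (a ω i * (θ ω - θS) j))
    (i1.sub h2.1) (integrable_bil S ha2 he2), integral_sub i1 h2.1,
    integral_finsetSum _ fun i _ => (h1 i).1, h2.2]
  simp only [(h1 _).2, hs.integral_residual, hSij, zero_mul, Finset.sum_const_zero, bil_eq_sum]
  ring

/-- Second moment of the stochastic gradient at a point `θ` independent of the observation, split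
along a reference point `p` as noise at `θS`, noise from `p - θS` and noise from `θ - p`. -/
lemma IsSample.integral_sqNorm_parts (hs : IsSample 𝒢 P S C κ θS x y) (hS : S.PosDef)
    [IsProbabilityMeasure P] (hind : Indep ℱ 𝒢 P)
    {θ : Ω → EuclideanSpace ℝ (Fin d)} (hθ : Measurable[ℱ] θ) (hθ2 : MemLp θ 2 P)
    (p : EuclideanSpace ℝ (Fin d)) (hM : M.PosSemidef) {c₁ c₂ : ℝ} (hc₂ : 0 ≤ c₂)
    (hsplit : ∀ u v w : EuclideanSpace ℝ (Fin d),
      sqNorm M (u + v + w) ≤ c₁ * sqNorm M u + c₂ * sqNorm M v + c₂ * sqNorm M w) :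
    ∫ ω, sqNorm M (residual x y (θ ω) ω) ∂P
      ≤ c₁ * (C * M).trace
        + c₂ * (κ * (M * S).trace * (sqNorm S (p - θS) + ∫ ω, sqNorm S (θ ω - p) ∂P)) := by
  have hv2 := hs.memLp_residual_of_indep hS hind hθ hθ2
  have h1 := hs.memLp_and_integral_le hS hind (hθ.sub_const p) (hθ2.sub (memLp_const p))
  have h2 := hs.memLp_and_integral_le hS hind (measurable_const (a := p - θS))
    (memLp_const (p - θS))
  have i1 := (integrable_sqNorm M hs.memLp_residual).const_mul c₁
  have i2 := (integrable_sqNorm M h2.1).const_mul c₂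
  have i3 := (integrable_sqNorm M h1.1).const_mul c₂
  have hle : ∫ ω, sqNorm M (residual x y (θ ω) ω) ∂P
      ≤ ∫ ω, (c₁ * sqNorm M (residual x y θS ω) + c₂ * sqNorm M (⟪x ω, p - θS⟫_ℝ • x ω)
        + c₂ * sqNorm M (⟪x ω, θ ω - p⟫_ℝ • x ω)) ∂P := by
    refine integral_mono (integrable_sqNorm M hv2) ((i1.add i2).add i3) fun ω => ?_
    have e1 : residual x y (θ ω) ω = residual x y θS ω + (-1 : ℝ) • (⟪x ω, p - θS⟫_ℝ • x ω)
        + (-1 : ℝ) • (⟪x ω, θ ω - p⟫_ℝ • x ω) := by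
      simp only [residual, inner_sub_right]; module
    have := hsplit (residual x y θS ω) ((-1 : ℝ) • (⟪x ω, p - θS⟫_ℝ • x ω))
      ((-1 : ℝ) • (⟪x ω, θ ω - p⟫_ℝ • x ω))
    rw [← e1] at this
    simpa only [sqNorm_smul _ (-1 : ℝ), neg_one_sq, one_mul] using this
  rw [integral_add (f := fun ω => c₁ * sqNorm M (residual x y θS ω)
      + c₂ * sqNorm M (⟪x ω, p - θS⟫_ℝ • x ω)) (i1.add i2) i3, integral_add i1 i2,
    integral_const_mul, integral_const_mul, integral_const_mul,
    integral_sqNorm_eq_trace M hs.memLp_residual, hs.secondMoment_residual] at hle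
  have h3 := mul_le_mul_of_nonneg_left (h1.2 M hM) hc₂
  have h4 := mul_le_mul_of_nonneg_left (h2.2 M hM) hc₂
  rw [integral_const, probReal_univ, one_smul] at h4
  linarith

/-- Centering decreases the second moment. -/
lemma IsSample.integral_sqNorm_noise_le (hs : IsSample 𝒢 P S C κ θS x y) (hS : S.PosDef)
    [IsFiniteMeasure P] (hind : Indep ℱ 𝒢 P) {θ : Ω → EuclideanSpace ℝ (Fin d)}
    (hθ : Measurable[ℱ] θ) (hθ2 : MemLp θ 2 P) :
    ∫ ω, sqNorm S⁻¹ (residual x y (θ ω) ω + act S (θ ω - θS)) ∂P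
      ≤ ∫ ω, sqNorm S⁻¹ (residual x y (θ ω) ω) ∂P := by
  have he : Measurable[ℱ] fun ω => θ ω - θS := hθ.sub_const θS
  have he2 : MemLp (fun ω => θ ω - θS) 2 P := hθ2.sub (memLp_const θS)
  have hv2 := hs.memLp_residual_of_indep hS hind hθ hθ2
  have hm2 : MemLp (fun ω => residual x y (θ ω) ω + act S (θ ω - θS)) 2 P :=
    hv2.add (memLp_act S he2)
  have hSS : S⁻¹ * S = 1 := Matrix.nonsing_inv_mul _ hS.det_pos.ne'.isUnit
  -- This is the bias-variance split: the cross term pairs the noise with the past and has zero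
  -- mean, and the squared mean is nonnegative.
  have hpt : ∀ ω, sqNorm S⁻¹ (residual x y (θ ω) ω)
      = sqNorm S⁻¹ (residual x y (θ ω) ω + act S (θ ω - θS))
        - 2 * ⟪residual x y (θ ω) ω + act S (θ ω - θS), θ ω - θS⟫_ℝ + sqNorm S (θ ω - θS) := by
    intro ω
    conv_lhs => rw [← add_sub_cancel_right (residual x y (θ ω) ω) (act S (θ ω - θS))]
    have e1 : sqNorm S⁻¹ (act S (θ ω - θS)) = sqNorm S (θ ω - θS) := by
      rw [sqNorm_eq_bil, bil_act_right, hSS, bil_one, real_inner_comm, inner_act_right]; rfl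
    rw [sqNorm_sub hS.inv.1, bil_act_right, hSS, bil_one, e1]
  have i1 := integrable_sqNorm S⁻¹ hm2
  have i2 := (integrable_inner_of_memLp hm2 he2).const_mul 2
  have i3 := integrable_sqNorm S he2
  have h0 := hs.integral_inner_noise hind hθ hθ2 he he2
  have h1 : 0 ≤ ∫ ω, sqNorm S (θ ω - θS) ∂P :=
    integral_nonneg fun ω => sqNorm_nonneg hS.posSemidef _
  simp only [hpt]
  have h2 : ∫ ω, (sqNorm S⁻¹ (residual x y (θ ω) ω + act S (θ ω - θS))
        - 2 * ⟪residual x y (θ ω) ω + act S (θ ω - θS), θ ω - θS⟫_ℝ + sqNorm S (θ ω - θS)) ∂P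
      = ∫ ω, sqNorm S⁻¹ (residual x y (θ ω) ω + act S (θ ω - θS)) ∂P
        - 2 * ∫ ω, ⟪residual x y (θ ω) ω + act S (θ ω - θS), θ ω - θS⟫_ℝ ∂P
        + ∫ ω, sqNorm S (θ ω - θS) ∂P := by
    rw [← integral_const_mul, ← integral_sub i1 i2]
    exact integral_add (i1.sub i2) i3
  rw [h2, h0]
  linarith

/-- The kurtosis constant is at least one. -/
lemma IsSample.one_le_kurtosis (hs : IsSample 𝒢 P S C κ θS x y)
    [IsProbabilityMeasure P] {w : EuclideanSpace ℝ (Fin d)} (hw : 0 < sqNorm S w) : 1 ≤ κ := by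
  have h2 : MemLp (fun ω => ⟪w, x ω⟫_ℝ) 2 P := hs.memLp_x.const_inner w
  have hvar : ∫ ω, ⟪w, x ω⟫_ℝ ^ 2 ∂P = sqNorm S w := by
    rw [integral_inner_sq hs.memLp_x, hs.secondMoment_x]
  set a := sqNorm S w
  have i4 := hs.integrable_inner_pow_four w
  have i2 := h2.integrable_sq
  -- The integrand is `(⟪w, x⟫² - a)²`, so the fourth moment is at least `a²`.
  have h5 : 0 ≤ ∫ ω, (⟪w, x ω⟫_ℝ ^ 4 - 2 * a * ⟪w, x ω⟫_ℝ ^ 2 + a ^ 2) ∂P :=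
    integral_nonneg fun ω => by
      have := sq_nonneg (⟪w, x ω⟫_ℝ ^ 2 - a)
      change 0 ≤ ⟪w, x ω⟫_ℝ ^ 4 - 2 * a * ⟪w, x ω⟫_ℝ ^ 2 + a ^ 2
      nlinarith
  have h6 : ∫ ω, (⟪w, x ω⟫_ℝ ^ 4 - 2 * a * ⟪w, x ω⟫_ℝ ^ 2 + a ^ 2) ∂P
      = ∫ ω, ⟪w, x ω⟫_ℝ ^ 4 ∂P - 2 * a * ∫ ω, ⟪w, x ω⟫_ℝ ^ 2 ∂P + a ^ 2 := by
    rw [← integral_const_mul, ← integral_sub i4 (i2.const_mul _)]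
    have := integral_add (i4.sub (i2.const_mul (2 * a))) (integrable_const (μ := P) (a ^ 2))
    rw [integral_const, probReal_univ, one_smul] at this
    exact this
  rw [h6, hvar] at h5
  have h7 := hs.integral_inner_pow_four_le w
  have h8 : 0 < a ^ 2 := by positivity
  change _ ≤ κ * a ^ 2 at h7
  nlinarith

end Sample

/-! ### Measurability, integrability and expected inequalities -/

section Expectation

variable {Ω : Type*} [mΩ : MeasurableSpace Ω] {P : Measure Ω} {d : ℕ}
  {g h : EuclideanSpace ℝ (Fin d) → EReal} {γ μ κ : ℝ}
  {S C M N : Matrix (Fin d) (Fin d) ℝ} {θ₀ p θS : EuclideanSpace ℝ (Fin d)}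
  {x : ℕ → Ω → EuclideanSpace ℝ (Fin d)} {y : ℕ → Ω → ℝ}
  {η θ : ℕ → Ω → EuclideanSpace ℝ (Fin d)} {ℱ 𝒢 : ℕ → MeasurableSpace Ω}

/-- No regularity of `φ` is needed. It gives measurability of the primal iterates as conjugate
gradients, with no measurable selection of minimizers. -/
lemma measurable_gradient (φ : EuclideanSpace ℝ (Fin d) → ℝ) : Measurable (gradient φ) :=
  (InnerProductSpace.toDual ℝ (EuclideanSpace ℝ (Fin d))).symm.continuous.measurable.comp
    (measurable_fderiv ℝ φ)

lemma IsSDA.dual_succ_residual {Ω : Type*} {x : ℕ → Ω → EuclideanSpace ℝ (Fin d)}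
    {y : ℕ → Ω → ℝ} {η θ : ℕ → Ω → EuclideanSpace ℝ (Fin d)} (hsda : IsSDA h g γ θ₀ x y η θ) (k : ℕ) (ω : Ω) :
    η (k + 1) ω = η k ω + γ • residual (x k) (y k) (θ k ω) ω := by
  rw [hsda.dual_succ, residual]; module

/-- The data of `ℱ k` (the past of step `k`) and `𝒢 k` (the observation used at step `k`). -/
structure IsSampling (P : Measure Ω) (S C : Matrix (Fin d) (Fin d) ℝ) (κ : ℝ)
    (θS : EuclideanSpace ℝ (Fin d)) (x : ℕ → Ω → EuclideanSpace ℝ (Fin d)) (y : ℕ → Ω → ℝ)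
    (ℱ 𝒢 : ℕ → MeasurableSpace Ω) : Prop where
  le : ∀ k, ℱ k ≤ mΩ
  mono : ∀ k, ℱ k ≤ ℱ (k + 1)
  obs_le : ∀ k, 𝒢 k ≤ ℱ (k + 1)
  indep : ∀ k, Indep (ℱ k) (𝒢 k) P
  sample : ∀ k, IsSample (𝒢 k) P S C κ θS (x k) (y k)

lemma IsSampling.measurable_residual (hsamp : IsSampling P S C κ θS x y ℱ 𝒢) {k : ℕ}
    {t : Ω → EuclideanSpace ℝ (Fin d)} (ht : Measurable[ℱ k] t) :
    Measurable[ℱ (k + 1)] fun ω => residual (x k) (y k) (t ω) ω := by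
  have hx : Measurable[ℱ (k + 1)] (x k) :=
    (hsamp.sample k).measurable_x.mono (hsamp.obs_le k) le_rfl
  have hy : Measurable[ℱ (k + 1)] (y k) :=
    (hsamp.sample k).measurable_y.mono (hsamp.obs_le k) le_rfl
  have ht' : Measurable[ℱ (k + 1)] t := ht.mono (hsamp.mono k) le_rfl
  exact (hy.sub (Measurable.inner hx ht')).smul hx

lemma IsSDA.measurable (hsda : IsSDA h g γ θ₀ x y η θ) (hsamp : IsSampling P S C κ θS x y ℱ 𝒢)
    (k : ℕ) : Measurable[ℱ k] (η k) ∧ Measurable[ℱ k] (θ k) := by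
  induction k with
  | zero =>
    rw [funext hsda.dual_zero, funext hsda.primal_zero]
    exact ⟨measurable_const, measurable_const⟩
  | succ k ih =>
    have h1 : Measurable[ℱ (k + 1)] (η (k + 1)) := by
      rw [funext (hsda.dual_succ_residual k)]
      exact (ih.1.mono (hsamp.mono k) le_rfl).add
        ((hsamp.measurable_residual ih.2).const_smul γ)
    refine ⟨h1, ?_⟩
    have h2 : θ (k + 1) = fun ω => gradient (finPart (conj (hReg h g γ (k + 1)))) (η (k + 1) ω) :=
      funext fun ω => (hsda.primal_succ k ω).2.gradient.symm
    rw [h2]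
    exact (measurable_gradient _).comp h1

variable [IsProbabilityMeasure P]

/-- Strong convexity gives `a ‖p - θ_k‖² ≤ A + ‖η₀ - η_k‖ ‖p - θ_k‖`, so `θ_k` grows at most
linearly with `η_k`. Induction then alternates: a square-integrable `θ_k` gives such an `η_{k+1}`,
which in turn gives such a `θ_{k+1}`. -/
lemma IsSDA.memLp (hsda : IsSDA h g γ θ₀ x y η θ) (hsamp : IsSampling P S C κ θS x y ℱ 𝒢)
    (hS : S.PosDef) (hM : M.PosSemidef) (hN : N.IsHermitian) (hMN : M * N = 1) (hμ : 0 < μ)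
    (hp : p ∈ effDom h ∩ effDom g) (hgnonneg : ∀ q, 0 ≤ g q) (hγ : 0 < γ)
    (hsub : ∀ k ω, θ k ω ∈ effDom h ∩ effDom g ∧ ∀ q ∈ effDom h ∩ effDom g,
      hRegReal h g γ k (θ k ω) + ⟪η k ω, q - θ k ω⟫_ℝ + μ / 2 * sqNorm M (q - θ k ω)
        ≤ hRegReal h g γ k q)
    (k : ℕ) : MemLp (η k) 2 P ∧ MemLp (θ k) 2 P := by
  obtain ⟨c, hc, hcM⟩ := exists_mul_norm_sq_le_sqNorm hM hN hMN
  have hη₀ : ∀ k, MemLp (η k) 2 P → MemLp (θ k) 2 P := by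
    intro k hk
    have hmeas : Measurable (θ k) := (hsda.measurable hsamp k).2.mono (hsamp.le k) le_rfl
    set η₀ := gradient (finPart h) θ₀ with hη₀
    set a := μ / 2 * c with ha
    have hapos : 0 < a := by positivity
    set A := hRegReal h g γ k p - finPart h θ₀ - ⟪η₀, p - θ₀⟫_ℝ with hA
    have hbound : ∀ ω, ‖p - θ k ω‖ ^ 2 ≤ 2 / a * A + 1 / a ^ 2 * ‖η₀ - η k ω‖ ^ 2 := by
      intro ω
      have h1 := (hsub k ω).2 p hp
      have h2 := (hsub 0 ω).2 _ (hsub k ω).1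
      have h3 := mul_nonneg (half_pos hμ).le (sqNorm_nonneg hM (θ k ω - θ 0 ω))
      have h4 : 0 ≤ k * γ * finPart g (θ k ω) :=
        mul_nonneg (by positivity) (EReal.toReal_nonneg (hgnonneg _))
      have h5 : ⟪η₀ - η k ω, p - θ k ω⟫_ℝ ≤ ‖η₀ - η k ω‖ * ‖p - θ k ω‖ := real_inner_le_norm _ _
      have h6 := mul_le_mul_of_nonneg_left (hcM (p - θ k ω)) (half_pos hμ).le
      rw [hsda.primal_zero, hsda.dual_zero, ← hη₀] at h2
      rw [hsda.primal_zero] at h3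
      simp only [hRegReal, Nat.cast_zero, zero_mul, add_zero] at h2
      rw [hRegReal] at h1
      have h7 : ⟪η₀ - η k ω, p - θ k ω⟫_ℝ
          = ⟪η₀, p - θ₀⟫_ℝ - ⟪η₀, θ k ω - θ₀⟫_ℝ - ⟪η k ω, p - θ k ω⟫_ℝ := by
        simp only [inner_sub_left, inner_sub_right]; ring
      set r := ‖p - θ k ω‖
      set s := ‖η₀ - η k ω‖
      have h8 : a * r ^ 2 ≤ A + s * r := by
        rw [ha, hA]; linarith
      have h9 : s * r ≤ 1 / (2 * a) * s ^ 2 + a / 2 * r ^ 2 := by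
        have : 1 / (2 * a) * s ^ 2 + a / 2 * r ^ 2 - s * r = (s - a * r) ^ 2 / (2 * a) := by
          field_simp; ring
        have : 0 ≤ (s - a * r) ^ 2 / (2 * a) := by positivity
        linarith
      have h10 : a / 2 * r ^ 2 ≤ A + 1 / (2 * a) * s ^ 2 := by linarith
      have h11 := mul_le_mul_of_nonneg_left h10 (show 0 ≤ 2 / a by positivity)
      have e1 : 2 / a * (a / 2 * r ^ 2) = r ^ 2 := by field_simp
      have e2 : 2 / a * (A + 1 / (2 * a) * s ^ 2) = 2 / a * A + 1 / a ^ 2 * s ^ 2 := by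
        field_simp
      linarith
    have hdiff : MemLp (fun ω => p - θ k ω) 2 P := by
      have hm : AEStronglyMeasurable (fun ω => p - θ k ω) P :=
        (measurable_const.sub hmeas).aestronglyMeasurable
      rw [memLp_two_iff_integrable_sq_norm hm]
      have hs : MemLp (fun ω => η₀ - η k ω) 2 P := (memLp_const η₀).sub hk
      have hs2 := (memLp_two_iff_integrable_sq_norm hs.1).1 hs
      refine Integrable.mono' ((integrable_const (2 / a * A)).add (hs2.const_mul (1 / a ^ 2)))
        (hm.norm.pow 2) (Eventually.of_forall fun ω => ?_)
      rw [Real.norm_of_nonneg (by positivity)]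
      exact hbound ω
    have : θ k = fun ω => p - (p - θ k ω) := by funext ω; abel
    rw [this]
    exact (memLp_const p).sub hdiff
  induction k with
  | zero =>
    have : MemLp (η 0) 2 P := by rw [funext hsda.dual_zero]; exact memLp_const _
    exact ⟨this, hη₀ 0 this⟩
  | succ k ih =>
    have : MemLp (η (k + 1)) 2 P := by
      rw [funext (hsda.dual_succ_residual k)]
      exact ih.1.add (((hsamp.sample k).memLp_residual_of_indep hS (hsamp.indep k)
        (hsda.measurable hsamp k).2 ih.2).const_smul γ)
    exact ⟨this, hη₀ _ this⟩

/-- Trajectory of the residuals at the iterates. -/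
noncomputable def residuals {Ω : Type*} (x : ℕ → Ω → EuclideanSpace ℝ (Fin d)) (y : ℕ → Ω → ℝ)
    (θ : ℕ → Ω → EuclideanSpace ℝ (Fin d)) (ω : Ω) (k : ℕ) : EuclideanSpace ℝ (Fin d) :=
  residual (x k) (y k) (θ k ω) ω

/-- Integrated energy inequality. -/
theorem sum_integral_sqNorm_le (hsamp : IsSampling P S C κ θS x y ℱ 𝒢) (hS : S.PosDef)
    (hθm : ∀ k, Measurable[ℱ k] (θ k)) (hθ2 : ∀ k, MemLp (θ k) 2 P)
    (hN : N.PosSemidef) (hγ : 0 < γ) (hμ : 0 < μ) {K : ℝ}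
    (hstep : γ * (4 * κ * (N * S).trace) ≤ μ) (n : ℕ)
    (hpath : ∀ ω, γ * ∑ k ∈ Finset.range n, sqNorm S (θ k ω - p)
      ≤ K + ∑ k ∈ Finset.range n,
        (γ * ⟪noise S θS (fun j => θ j ω) (residuals x y θ ω) k, θ k ω - p⟫_ℝ
          + γ ^ 2 / (2 * μ) * sqNorm N (residuals x y θ ω k))) :
    ∑ k ∈ Finset.range n, ∫ ω, sqNorm S (θ k ω - p) ∂P
      ≤ 2 / γ * K + n * (γ / μ * (2 * (C * N).trace
        + 4 * κ * (N * S).trace * sqNorm S (p - θS))) := by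
  have hv2 : ∀ k, MemLp (fun ω => residual (x k) (y k) (θ k ω) ω) 2 P := fun k =>
    (hsamp.sample k).memLp_residual_of_indep hS (hsamp.indep k) (hθm k) (hθ2 k)
  have hδ2 : ∀ k, MemLp (fun ω => θ k ω - p) 2 P := fun k => (hθ2 k).sub (memLp_const p)
  have hm2 : ∀ k, MemLp (fun ω => residual (x k) (y k) (θ k ω) ω + act S (θ k ω - θS)) 2 P :=
    fun k => (hv2 k).add (memLp_act S ((hθ2 k).sub (memLp_const θS)))
  have iV : ∀ k, Integrable (fun ω => sqNorm S (θ k ω - p)) P := fun k =>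
    integrable_sqNorm S (hδ2 k)
  have i1 : ∀ k, Integrable (fun ω =>
      γ * ⟪residual (x k) (y k) (θ k ω) ω + act S (θ k ω - θS), θ k ω - p⟫_ℝ) P := fun k =>
    (integrable_inner_of_memLp (hm2 k) (hδ2 k)).const_mul γ
  have i2 : ∀ k, Integrable (fun ω =>
      γ ^ 2 / (2 * μ) * sqNorm N (residual (x k) (y k) (θ k ω) ω)) P := fun k =>
    (integrable_sqNorm N (hv2 k)).const_mul _
  have i12 : ∀ k ∈ Finset.range n, Integrable (fun ω =>
      γ * ⟪residual (x k) (y k) (θ k ω) ω + act S (θ k ω - θS), θ k ω - p⟫_ℝ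
        + γ ^ 2 / (2 * μ) * sqNorm N (residual (x k) (y k) (θ k ω) ω)) P := fun k _ =>
    (i1 k).add (i2 k)
  have hint : ∫ ω, γ * ∑ k ∈ Finset.range n, sqNorm S (θ k ω - p) ∂P
      ≤ ∫ ω, (K + ∑ k ∈ Finset.range n,
        (γ * ⟪residual (x k) (y k) (θ k ω) ω + act S (θ k ω - θS), θ k ω - p⟫_ℝ
          + γ ^ 2 / (2 * μ) * sqNorm N (residual (x k) (y k) (θ k ω) ω))) ∂P := by
    refine integral_mono ((integrable_finsetSum _ fun k _ => iV k).const_mul γ)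
      ((integrable_const K).add (integrable_finsetSum _ i12)) hpath
  rw [integral_const_mul, integral_finsetSum _ fun k _ => iV k,
    integral_add (integrable_const K) (integrable_finsetSum _ i12),
    integral_const, probReal_univ, one_smul,
    integral_finsetSum _ i12] at hint
  -- The step-size condition turns the multiplicative noise into at most half of `γ 𝔼‖θ_k - p‖²`,
  -- which the left side absorbs below. Splitting weights `2, 4, 4` keep the coefficient of `tr(CN)`
  -- small and account for the `4` in `hstep`.
  have hterm : ∀ k, ∫ ω, (γ * ⟪residual (x k) (y k) (θ k ω) ω + act S (θ k ω - θS), θ k ω - p⟫_ℝ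
          + γ ^ 2 / (2 * μ) * sqNorm N (residual (x k) (y k) (θ k ω) ω)) ∂P
      ≤ γ ^ 2 / (2 * μ) * (2 * (C * N).trace + 4 * κ * (N * S).trace * sqNorm S (p - θS))
        + γ / 2 * ∫ ω, sqNorm S (θ k ω - p) ∂P := by
    intro k
    have h0 : 0 ≤ ∫ ω, sqNorm S (θ k ω - p) ∂P :=
      integral_nonneg fun ω => sqNorm_nonneg hS.posSemidef _
    rw [integral_add (i1 k) (i2 k), integral_const_mul, integral_const_mul,
      (hsamp.sample k).integral_inner_noise (hsamp.indep k) (hθm k) (hθ2 k)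
        ((hθm k).sub_const p) (hδ2 k)]
    have h1 := mul_le_mul_of_nonneg_left ((hsamp.sample k).integral_sqNorm_parts hS (hsamp.indep k)
      (hθm k) (hθ2 k) p hN (c₁ := 2) (c₂ := 4) (by norm_num) (sqNorm_add_three_le hN))
      (show 0 ≤ γ ^ 2 / (2 * μ) by positivity)
    have h2 := mul_le_mul_of_nonneg_right hstep h0
    have h3 := mul_le_mul_of_nonneg_left h2 (show 0 ≤ γ / (2 * μ) by positivity)
    have e3 : γ / (2 * μ) * (μ * ∫ ω, sqNorm S (θ k ω - p) ∂P)
        = γ / 2 * ∫ ω, sqNorm S (θ k ω - p) ∂P := by field_simp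
    rw [e3] at h3
    refine le_trans (le_of_eq (by ring)) (h1.trans ?_)
    refine le_trans (le_of_eq ?_) (add_le_add le_rfl h3)
    ring
  have hsum := Finset.sum_le_sum fun k (_ : k ∈ Finset.range n) => hterm k
  rw [Finset.sum_add_distrib, Finset.sum_const, Finset.card_range, nsmul_eq_mul,
    ← Finset.mul_sum] at hsum
  have hfin := hint.trans (add_le_add (le_refl K) hsum)
  set T := ∑ k ∈ Finset.range n, ∫ ω, sqNorm S (θ k ω - p) ∂P
  set B := 2 * (C * N).trace + 4 * κ * (N * S).trace * sqNorm S (p - θS)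
  have h4 : γ / 2 * T ≤ K + n * (γ ^ 2 / (2 * μ) * B) := by linarith
  have h5 := mul_le_mul_of_nonneg_left h4 (show 0 ≤ 2 / γ by positivity)
  have e1 : 2 / γ * (γ / 2 * T) = T := by field_simp
  have e2 : 2 / γ * (K + n * (γ ^ 2 / (2 * μ) * B)) = 2 / γ * K + n * (γ / μ * B) := by
    field_simp
  linarith

/-- Integrated control of the averaged iterate. -/
theorem half_integral_sqNorm_sum_le (hsamp : IsSampling P S C κ θS x y ℱ 𝒢) (hS : S.PosDef)
    (hθm : ∀ k, Measurable[ℱ k] (θ k)) (hθ2 : ∀ k, MemLp (θ k) 2 P) {K : ℝ} (n : ℕ)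
    (hpath : ∀ ω, sqNorm S (denoisedSum S p θS (fun j => θ j ω) (residuals x y θ ω) n)
      ≤ K + ∑ k ∈ Finset.range n,
        (sqNorm S (θ k ω - p - act S⁻¹ (noise S θS (fun j => θ j ω) (residuals x y θ ω) k))
          - 2 * ⟪noise S θS (fun j => θ j ω) (residuals x y θ ω) k,
            denoisedSum S p θS (fun j => θ j ω) (residuals x y θ ω) k⟫_ℝ)) :
    ∫ ω, 1 / 2 * sqNorm S (∑ k ∈ Finset.range n, (θ k ω - p)) ∂P
      ≤ K + ∑ k ∈ Finset.range n, (∫ ω, sqNorm S (θ k ω - p) ∂P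
        + 6 * ((C * S⁻¹).trace
          + κ * d * (sqNorm S (p - θS) + ∫ ω, sqNorm S (θ k ω - p) ∂P))) := by
  have hSS : S * S⁻¹ = 1 := Matrix.mul_nonsing_inv _ hS.det_pos.ne'.isUnit
  have hSS' : S⁻¹ * S = 1 := Matrix.nonsing_inv_mul _ hS.det_pos.ne'.isUnit
  set m : ℕ → Ω → EuclideanSpace ℝ (Fin d) := fun k ω =>
    residual (x k) (y k) (θ k ω) ω + act S (θ k ω - θS) with hm
  have hnoise : ∀ k ω, noise S θS (fun j => θ j ω) (residuals x y θ ω) k = m k ω :=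
    fun k ω => rfl
  simp only [hnoise] at hpath
  set W : ℕ → Ω → EuclideanSpace ℝ (Fin d) := fun k ω =>
    denoisedSum S p θS (fun j => θ j ω) (residuals x y θ ω) k with hW
  set U : ℕ → Ω → EuclideanSpace ℝ (Fin d) := fun k ω =>
    ∑ j ∈ Finset.range k, act S⁻¹ (m j ω) with hU
  have hv2 : ∀ k, MemLp (fun ω => residual (x k) (y k) (θ k ω) ω) 2 P := fun k =>
    (hsamp.sample k).memLp_residual_of_indep hS (hsamp.indep k) (hθm k) (hθ2 k)
  have hδ2 : ∀ k, MemLp (fun ω => θ k ω - p) 2 P := fun k => (hθ2 k).sub (memLp_const p)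
  have hm2 : ∀ k, MemLp (m k) 2 P :=
    fun k => (hv2 k).add (memLp_act S ((hθ2 k).sub (memLp_const θS)))
  have hmm : ∀ k, Measurable[ℱ (k + 1)] (m k) := fun k =>
    (hsamp.measurable_residual (hθm k)).add ((continuous_act S).measurable.comp
      (((hθm k).mono (hsamp.mono k) le_rfl).sub_const θS))
  -- Only noises of index below `k` enter `W k` and `U k`, so both are independent of observation
  -- `k` and orthogonal to `m k`.
  have hWm : ∀ k, Measurable[ℱ k] (W k) ∧ MemLp (W k) 2 P := by
    intro k
    induction k with
    | zero => exact ⟨measurable_const (a := (0 : EuclideanSpace ℝ (Fin d))),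
        MemLp.zero (ε := EuclideanSpace ℝ (Fin d))⟩
    | succ k ih =>
      have : W (k + 1) = fun ω => W k ω + (θ k ω - p - act S⁻¹ (m k ω)) := by
        funext ω
        simp only [hW, denoisedSum, Finset.sum_range_succ]
        rfl
      rw [this]
      exact ⟨(ih.1.mono (hsamp.mono k) le_rfl).add
        ((((hθm k).mono (hsamp.mono k) le_rfl).sub_const p).sub
          ((continuous_act S⁻¹).measurable.comp (hmm k))),
        ih.2.add ((hδ2 k).sub (memLp_act S⁻¹ (hm2 k)))⟩
  have hUm : ∀ k, Measurable[ℱ k] (U k) ∧ MemLp (U k) 2 P := by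
    intro k
    induction k with
    | zero => exact ⟨measurable_const (a := (0 : EuclideanSpace ℝ (Fin d))),
        MemLp.zero (ε := EuclideanSpace ℝ (Fin d))⟩
    | succ k ih =>
      have : U (k + 1) = fun ω => U k ω + act S⁻¹ (m k ω) := by
        funext ω
        simp only [hU, Finset.sum_range_succ]
      rw [this]
      exact ⟨(ih.1.mono (hsamp.mono k) le_rfl).add
          ((continuous_act S⁻¹).measurable.comp (hmm k)),
        ih.2.add (memLp_act S⁻¹ (hm2 k))⟩
  have hortho : ∀ k (a : Ω → EuclideanSpace ℝ (Fin d)), Measurable[ℱ k] a → MemLp a 2 P →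
      ∫ ω, ⟪m k ω, a ω⟫_ℝ ∂P = 0 := fun k a ha ha2 =>
    (hsamp.sample k).integral_inner_noise (hsamp.indep k) (hθm k) (hθ2 k) ha ha2
  have hq : ∀ k ω, sqNorm S (act S⁻¹ (m k ω)) = sqNorm S⁻¹ (m k ω) := fun k ω => by
    rw [sqNorm_eq_bil, bil_act_right, hSS, bil_one, real_inner_comm, inner_act_right]; rfl
  have hb : ∀ k ω u, bil S u (act S⁻¹ (m k ω)) = ⟪m k ω, u⟫_ℝ := fun k ω u => by
    rw [bil_act_right, hSS, bil_one, real_inner_comm]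
  have hmk : ∀ k, ∫ ω, sqNorm S⁻¹ (m k ω) ∂P ≤ 3 * ((C * S⁻¹).trace
      + κ * d * (sqNorm S (p - θS) + ∫ ω, sqNorm S (θ k ω - p) ∂P)) := by
    intro k
    have h1 := ((hsamp.sample k).integral_sqNorm_noise_le hS (hsamp.indep k) (hθm k)
      (hθ2 k)).trans ((hsamp.sample k).integral_sqNorm_parts hS (hsamp.indep k)
      (hθm k) (hθ2 k) p hS.inv.posSemidef (c₁ := 3) (c₂ := 3) (by norm_num)
      (sqNorm_add_three_le' hS.inv.posSemidef))
    -- The dimension enters here, as the trace of `S⁻¹ * S`.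
    rw [hSS', Matrix.trace_one, Fintype.card_fin] at h1
    exact h1.trans (le_of_eq (by ring))
  -- Pythagoras for orthogonal martingale increments.
  have hUsq : ∀ k, ∫ ω, sqNorm S (U k ω) ∂P
      = ∑ j ∈ Finset.range k, ∫ ω, sqNorm S⁻¹ (m j ω) ∂P := by
    intro k
    induction k with
    | zero => simp [hU, sqNorm]
    | succ k ih =>
      have hpt : ∀ ω, sqNorm S (U (k + 1) ω)
          = sqNorm S (U k ω) + 2 * ⟪m k ω, U k ω⟫_ℝ + sqNorm S⁻¹ (m k ω) := by
        intro ω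
        simp only [hU, Finset.sum_range_succ]
        rw [sqNorm_add hS.1, hb, hq]
      simp only [hpt]
      have i1 := integrable_sqNorm S (hUm k).2
      have i2 := (integrable_inner_of_memLp (hm2 k) (hUm k).2).const_mul 2
      have i3 := integrable_sqNorm S⁻¹ (hm2 k)
      rw [integral_add (f := fun ω => sqNorm S (U k ω) + 2 * ⟪m k ω, U k ω⟫_ℝ) (i1.add i2) i3,
        integral_add i1 i2, integral_const_mul, hortho k _ (hUm k).1 (hUm k).2, ih,
        Finset.sum_range_succ]
      ring
  have hWsq : ∫ ω, sqNorm S (W n ω) ∂P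
      ≤ K + ∑ k ∈ Finset.range n, (∫ ω, sqNorm S (θ k ω - p) ∂P + ∫ ω, sqNorm S⁻¹ (m k ω) ∂P) := by
    have iA : ∀ k, Integrable (fun ω => sqNorm S (θ k ω - p - act S⁻¹ (m k ω))) P := fun k =>
      integrable_sqNorm S ((hδ2 k).sub (memLp_act S⁻¹ (hm2 k)))
    have iB : ∀ k, Integrable (fun ω => 2 * ⟪m k ω, W k ω⟫_ℝ) P := fun k =>
      (integrable_inner_of_memLp (hm2 k) (hWm k).2).const_mul 2
    have iAB : ∀ k ∈ Finset.range n, Integrable (fun ω =>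
        sqNorm S (θ k ω - p - act S⁻¹ (m k ω)) - 2 * ⟪m k ω, W k ω⟫_ℝ) P := fun k _ =>
      (iA k).sub (iB k)
    have h1 : ∫ ω, sqNorm S (W n ω) ∂P ≤ ∫ ω, (K + ∑ k ∈ Finset.range n,
        (sqNorm S (θ k ω - p - act S⁻¹ (m k ω)) - 2 * ⟪m k ω, W k ω⟫_ℝ)) ∂P :=
      integral_mono (integrable_sqNorm S (hWm n).2)
        ((integrable_const K).add (integrable_finsetSum _ iAB)) hpath
    rw [integral_add (integrable_const K) (integrable_finsetSum _ iAB),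
      integral_const, probReal_univ, one_smul,
      integral_finsetSum _ iAB] at h1
    refine h1.trans (le_of_eq ?_)
    congr 1
    refine Finset.sum_congr rfl fun k _ => ?_
    rw [integral_sub (iA k) (iB k), integral_const_mul, hortho k _ (hWm k).1 (hWm k).2]
    have hpt : ∀ ω, sqNorm S (θ k ω - p - act S⁻¹ (m k ω))
        = sqNorm S (θ k ω - p) - 2 * ⟪m k ω, θ k ω - p⟫_ℝ + sqNorm S⁻¹ (m k ω) := fun ω => by
      rw [sqNorm_sub hS.1, hb, hq]
    simp only [hpt]
    have i1 := integrable_sqNorm S (hδ2 k)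
    have i2 := (integrable_inner_of_memLp (hm2 k) (hδ2 k)).const_mul 2
    have i3 := integrable_sqNorm S⁻¹ (hm2 k)
    rw [integral_add (f := fun ω => sqNorm S (θ k ω - p) - 2 * ⟪m k ω, θ k ω - p⟫_ℝ)
      (i1.sub i2) i3, integral_sub i1 i2, integral_const_mul,
      hortho k _ ((hθm k).sub_const p) (hδ2 k)]
    ring
  have hsum2 : MemLp (fun ω => ∑ k ∈ Finset.range n, (θ k ω - p)) 2 P :=
    memLp_finsetSum _ fun k _ => hδ2 k
  have hlast : ∫ ω, 1 / 2 * sqNorm S (∑ k ∈ Finset.range n, (θ k ω - p)) ∂P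
      ≤ ∫ ω, (sqNorm S (W n ω) + sqNorm S (U n ω)) ∂P :=
    integral_mono ((integrable_sqNorm S hsum2).const_mul _)
      ((integrable_sqNorm S (hWm n).2).add (integrable_sqNorm S (hUm n).2))
      fun ω => half_sqNorm_sum_le hS n
  rw [integral_add (integrable_sqNorm S (hWm n).2) (integrable_sqNorm S (hUm n).2), hUsq] at hlast
  have hsum := Finset.sum_le_sum fun k (_ : k ∈ Finset.range n) => hmk k
  have hfin : ∑ k ∈ Finset.range n, (∫ ω, sqNorm S (θ k ω - p) ∂P + 6 * ((C * S⁻¹).trace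
          + κ * d * (sqNorm S (p - θS) + ∫ ω, sqNorm S (θ k ω - p) ∂P)))
      = ∑ k ∈ Finset.range n, ∫ ω, sqNorm S (θ k ω - p) ∂P
        + 2 * ∑ k ∈ Finset.range n, 3 * ((C * S⁻¹).trace
          + κ * d * (sqNorm S (p - θS) + ∫ ω, sqNorm S (θ k ω - p) ∂P)) := by
    rw [Finset.mul_sum, ← Finset.sum_add_distrib]
    exact Finset.sum_congr rfl fun k _ => by ring
  rw [hfin]
  rw [Finset.sum_add_distrib] at hWsq
  linarith

end Expectation

/-! ### From the least-squares model to the abstract sampling scheme -/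

section Model

variable {Ω : Type*} [mΩ : MeasurableSpace Ω] {P : Measure Ω} {d : ℕ}

/-- Numerical combination of the bound on the averaged iterate and of the energy bound. -/
lemma combine_bounds {n d κ γ μ K G a c τ Q T I : ℝ} (hn : 0 < n) (hγ : 0 < γ) (hμ : 0 < μ)
    (hκd : 1 ≤ κ * d) (hK : 0 ≤ K) (hG : 0 ≤ G) (ha : 0 ≤ a) (hc : 0 ≤ c)
    (hQ : 0 ≤ Q) (hτ : 0 ≤ κ * τ)
    (hI : I ≤ n * (2 / γ * K) + (T + 6 * (n * c + κ * d * (n * Q + T))))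
    (hT : T ≤ 2 / γ * (K + γ * G) + n * (γ / μ * (2 * a + 4 * κ * τ * Q))) :
    1 / n ^ 2 * I ≤ 2 / (γ * n) * K
      + (24 / n * c + 16 * κ * d * γ / (n * μ) * a
        + 8 * κ * d / n * (4 * κ * γ * τ / μ + 3) * Q)
      + 80 * (κ * d / (γ * n ^ 2)) * K + 16 * κ * d / n ^ 2 * G := by
  have hκd0 : 0 < κ * d := by linarith
  obtain ⟨r, hr, hr0⟩ : ∃ r, r = κ * d ∧ 0 < r := ⟨_, rfl, hκd0⟩
  obtain ⟨s, hs, hs0⟩ : ∃ s, s = κ * τ ∧ 0 ≤ s := ⟨_, rfl, hτ⟩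
  set B := 2 / γ * (K + γ * G) + n * (γ / μ * (2 * a + 4 * κ * τ * Q)) with hB
  have hB' : B = 2 / γ * (K + γ * G) + n * (γ / μ * (2 * a + 4 * s * Q)) := by
    rw [hB, hs]; ring
  have hB0 : 0 ≤ B := by rw [hB']; positivity
  -- `1 ≤ κ d` merges the energy with its multiple by `6 κ d`.
  have h1 : T + 6 * (r * T) ≤ 7 * r * B := by
    rw [← hr] at hκd
    nlinarith
  have h2 : I ≤ n * (2 / γ * K) + 6 * (n * c) + 6 * (r * (n * Q)) + 7 * r * B := by
    rw [hr] at *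
    linarith
  have h3 := mul_le_mul_of_nonneg_left h2 (show 0 ≤ 1 / n ^ 2 by positivity)
  refine h3.trans (sub_nonneg.mp ?_)
  -- The slack is a sum of nonnegative terms, with coefficients such as `18 = 24 - 6`, `66 = 80 -
  -- 14` and `2 = 16 - 14`.
  have key : 2 / (γ * n) * K
      + (24 / n * c + 16 * κ * d * γ / (n * μ) * a
        + 8 * κ * d / n * (4 * κ * γ * τ / μ + 3) * Q)
      + 80 * (κ * d / (γ * n ^ 2)) * K + 16 * κ * d / n ^ 2 * G
      - 1 / n ^ 2 * (n * (2 / γ * K) + 6 * (n * c) + 6 * (r * (n * Q)) + 7 * r * B)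
      = 18 * c / n + 18 * r * Q / n + 66 * r * K / (γ * n ^ 2) + 2 * r * G / n ^ 2
        + 2 * r * γ * a / (n * μ) + 4 * r * s * γ * Q / (n * μ) := by
    rw [hB', hr, hs]
    field_simp
    ring
  rw [key]
  positivity

lemma memLp_inner_sub {X : Ω → EuclideanSpace ℝ (Fin d)} {Y : Ω → ℝ} (hX : MemLp X 2 P)
    (hY : MemLp Y 2 P) (θ : EuclideanSpace ℝ (Fin d)) :
    MemLp (fun ω => ⟪X ω, θ⟫_ℝ - Y ω) 2 P :=
  (hX.inner_const θ).sub hY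

/-- Second-order expansion of the least-squares risk. -/
lemma risk_add {X : Ω → EuclideanSpace ℝ (Fin d)} {Y : Ω → ℝ} (hX : MemLp X 2 P)
    (hY : MemLp Y 2 P) (θ v : EuclideanSpace ℝ (Fin d)) :
    risk P X Y (θ + v) = risk P X Y θ - ∫ ω, ⟪residual X Y θ ω, v⟫_ℝ ∂P
      + 1 / 2 * sqNorm (secondMoment P X) v := by
  have h1 := memLp_inner_sub hX hY θ
  have h2 : MemLp (fun ω => ⟪v, X ω⟫_ℝ) 2 P := hX.const_inner v
  have i1 := h1.integrable_sq
  have i2 := h2.integrable_sq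
  have i3 : Integrable (fun ω => ⟪residual X Y θ ω, v⟫_ℝ) P := by
    have := (h1.integrable_mul h2).neg
    refine this.congr (Eventually.of_forall fun ω => ?_)
    simp only [Pi.neg_apply, Pi.mul_apply, residual, real_inner_smul_left,
      real_inner_comm (X ω) v]
    ring
  have hpt : ∀ ω, (⟪X ω, θ + v⟫_ℝ - Y ω) ^ 2
      = (⟪X ω, θ⟫_ℝ - Y ω) ^ 2 - 2 * ⟪residual X Y θ ω, v⟫_ℝ + ⟪v, X ω⟫_ℝ ^ 2 := by
    intro ω
    rw [residual, real_inner_smul_left, inner_add_right, real_inner_comm (X ω) v]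
    ring
  unfold risk
  simp only [hpt]
  rw [integral_add (f := fun ω => (⟪X ω, θ⟫_ℝ - Y ω) ^ 2 - 2 * ⟪residual X Y θ ω, v⟫_ℝ)
    (i1.sub (i3.const_mul 2)) i2, integral_sub i1 (i3.const_mul 2), integral_const_mul,
    integral_inner_sq hX]
  ring

/-- Normal equations at the global minimizer of the risk. -/
lemma integral_inner_residual_eq_zero {X : Ω → EuclideanSpace ℝ (Fin d)}
    {Y : Ω → ℝ} {θS : EuclideanSpace ℝ (Fin d)} (hX : MemLp X 2 P) (hY : MemLp Y 2 P)
    (hmin : ∀ θ, risk P X Y θS ≤ risk P X Y θ) (v : EuclideanSpace ℝ (Fin d)) :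
    ∫ ω, ⟪residual X Y θS ω, v⟫_ℝ ∂P = 0 := by
  have hle : ∀ u : EuclideanSpace ℝ (Fin d), ∫ ω, ⟪residual X Y θS ω, u⟫_ℝ ∂P ≤ 0 := by
    intro u
    refine le_of_forall_sub_mul_le (c := 1 / 2 * sqNorm (secondMoment P X) u) fun t ht => ?_
    have h1 := hmin (θS + t • u)
    rw [risk_add hX hY] at h1
    simp only [inner_smul_right] at h1
    rw [integral_const_mul, sqNorm_smul] at h1
    have h2 : t * (∫ ω, ⟪residual X Y θS ω, u⟫_ℝ ∂P
        - t * (1 / 2 * sqNorm (secondMoment P X) u)) ≤ t * 0 := by nlinarith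
    exact le_of_mul_le_mul_left h2 ht.1
  refine le_antisymm (hle v) ?_
  have := hle (-v)
  simp only [inner_neg_right, integral_neg] at this
  linarith

/-- The risk is exactly quadratic, and its linear term at the global minimizer vanishes by the
normal equations. -/
lemma risk_eq_add {X : Ω → EuclideanSpace ℝ (Fin d)}
    {Y : Ω → ℝ} {θS : EuclideanSpace ℝ (Fin d)} (hX : MemLp X 2 P) (hY : MemLp Y 2 P)
    (hmin : ∀ θ, risk P X Y θS ≤ risk P X Y θ) (θ : EuclideanSpace ℝ (Fin d)) :
    risk P X Y θ = risk P X Y θS + 1 / 2 * sqNorm (secondMoment P X) (θ - θS) := by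
  have h1 := risk_add hX hY θS (θ - θS)
  rw [add_sub_cancel, integral_inner_residual_eq_zero hX hY hmin] at h1
  linarith

/-- The kurtosis assumption speaks only of linear forms; applied to coordinates, it suffices because
`‖X‖⁴ ≤ d ∑ X_i⁴` by Cauchy–Schwarz. -/
lemma integrable_norm_pow_four {X : Ω → EuclideanSpace ℝ (Fin d)}
    (hX : AEStronglyMeasurable X P)
    (hX4 : ∀ z : EuclideanSpace ℝ (Fin d), Integrable (fun ω => ⟪z, X ω⟫_ℝ ^ 4) P) :
    Integrable (fun ω => ‖X ω‖ ^ 4) P := by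
  have hcoord : ∀ i, Integrable (fun ω => X ω i ^ 4) P := fun i => by
    have := hX4 (EuclideanSpace.single i 1)
    simpa [EuclideanSpace.inner_single_left] using this
  refine Integrable.mono' ((integrable_finsetSum Finset.univ fun i _ => hcoord i).const_mul (d : ℝ))
    (hX.norm.pow 4) (Eventually.of_forall fun ω => ?_)
  rw [Real.norm_of_nonneg (by positivity)]
  have h1 : ‖X ω‖ ^ 4 = (∑ i, X ω i ^ 2) ^ 2 := by
    rw [show ‖X ω‖ ^ 4 = (‖X ω‖ ^ 2) ^ 2 by ring, EuclideanSpace.real_norm_sq_eq]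
  have h2 := sq_sum_le_card_mul_sum_sq (s := Finset.univ) (f := fun i => X ω i ^ 2)
  rw [h1]
  simpa [← pow_mul] using h2

/-- Independent and identically distributed observations provide a sampling scheme. -/
theorem isSampling_of_iIndepFun [IsProbabilityMeasure P]
    {x : ℕ → Ω → EuclideanSpace ℝ (Fin d)} {y : ℕ → Ω → ℝ}
    (hx : ∀ n, Measurable (x n)) (hy : ∀ n, Measurable (y n))
    (hindep : iIndepFun (fun n ω => (x n ω, y n ω)) P)
    (hident : ∀ n, IdentDistrib (fun ω => (x n ω, y n ω)) (fun ω => (x 0 ω, y 0 ω)) P P)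
    (hx2 : MemLp (x 0) 2 P) (hy2 : MemLp (y 0) 2 P)
    {S C : Matrix (Fin d) (Fin d) ℝ} (hS : S = secondMoment P (x 0))
    {θS : EuclideanSpace ℝ (Fin d)}
    (hθS : ∀ θ, risk P (x 0) (y 0) θS ≤ risk P (x 0) (y 0) θ)
    (hC : C = secondMoment P (residual (x 0) (y 0) θS))
    (hξ : MemLp (residual (x 0) (y 0) θS) 2 P) {κ : ℝ}
    (hkurt : ∀ z : EuclideanSpace ℝ (Fin d), Integrable (fun ω => ⟪z, x 0 ω⟫_ℝ ^ 4) P ∧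
      ∫ ω, ⟪z, x 0 ω⟫_ℝ ^ 4 ∂P ≤ κ * sqNorm S z ^ 2) :
    IsSampling P S C κ θS x y
      (fun k => ⨆ j ∈ {j | j < k},
        MeasurableSpace.comap (fun ω => (x j ω, y j ω)) inferInstance)
      (fun k => MeasurableSpace.comap (fun ω => (x k ω, y k ω)) inferInstance) := by
  have hle : ∀ k, MeasurableSpace.comap (fun ω => (x k ω, y k ω)) inferInstance ≤ mΩ := fun k =>
    ((hx k).prodMk (hy k)).comap_le
  have hcomap : ∀ k, Measurable[MeasurableSpace.comap (fun ω => (x k ω, y k ω)) inferInstance]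
      (fun ω => (x k ω, y k ω)) := fun k => comap_measurable _
  refine ⟨fun k => iSup₂_le fun j _ => hle j, fun k => ?_, fun k => ?_, fun k => ?_, fun k => ?_⟩
  · exact iSup₂_le fun j hj => le_iSup₂_of_le j (Nat.lt_succ_of_lt hj) le_rfl
  · exact le_iSup₂_of_le k (Nat.lt_succ_self k) le_rfl
  -- The past of step `k` uses indices strictly below `k`, disjoint from the index `k` of the
  -- observation consumed there.
  · have h1 := indep_iSup_of_disjoint hle ((iIndepFun_iff_iIndep _ _ _).mp hindep)
      (S := {j | j < k}) (T := {k}) (by simp)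
    simpa only [iSup_singleton, Set.mem_singleton_iff, iSup_iSup_eq_left] using h1
  · have hXid : IdentDistrib (x k) (x 0) P P := (hident k).comp measurable_fst
    have hres : Measurable fun z : EuclideanSpace ℝ (Fin d) × ℝ =>
        (z.2 - ⟪z.1, θS⟫_ℝ) • z.1 := by fun_prop
    have hRid : IdentDistrib (residual (x k) (y k) θS) (residual (x 0) (y 0) θS) P P :=
      (hident k).comp hres
    have hinner : ∀ z : EuclideanSpace ℝ (Fin d), Measurable fun u => ⟪z, u⟫_ℝ ^ 4 := fun z => by
      fun_prop
    have hnorm : Measurable fun u : EuclideanSpace ℝ (Fin d) => ‖u‖ ^ 4 := by fun_prop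
    have hprod : ∀ i j, Measurable fun u : EuclideanSpace ℝ (Fin d) => u i * u j := fun i j => by
      fun_prop
    have hcoord : ∀ i, Measurable fun u : EuclideanSpace ℝ (Fin d) => u i := fun i => by
      fun_prop
    refine ⟨measurable_fst.comp (hcomap k), measurable_snd.comp (hcomap k),
      hXid.memLp_iff.mpr hx2, ?_, ?_, fun z => ?_, hRid.memLp_iff.mpr hξ, fun i => ?_, ?_⟩
    · exact (hXid.comp hnorm).integrable_iff.mpr
        (integrable_norm_pow_four hx2.1 fun z => (hkurt z).1)
    · rw [hS]
      ext i j
      exact (hXid.comp (hprod i j)).integral_eq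
    · exact (hXid.comp (hinner z)).integral_eq.trans_le (hkurt z).2
    · refine (hRid.comp (hcoord i)).integral_eq.trans ?_
      have := integral_inner_residual_eq_zero hx2 hy2 hθS (EuclideanSpace.single i 1)
      simpa [EuclideanSpace.inner_single_right] using this
    · rw [hC]
      ext i j
      exact (hRid.comp (hprod i j)).integral_eq

/-! ### The constrained minimizer -/

section Optimality

variable {g h : EuclideanSpace ℝ (Fin d) → EReal} {X : Set (EuclideanSpace ℝ (Fin d))}
  {θstar θS : EuclideanSpace ℝ (Fin d)} {S : Matrix (Fin d) (Fin d) ℝ}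
  {f : EuclideanSpace ℝ (Fin d) → ℝ}

/-- Comparison with a qualification point, where `f + g` is finite, forces `g` to be finite at the
minimizer. -/
lemma isMin_mem_effDom (hg : IsProperLscConvex g)
    (hqual : (interior (effDom h) ∩ effDom g).Nonempty)
    (hX : X = closure (effDom h) ∩ closure (effDom g))
    (hmin : ∀ θ ∈ X, ((f θstar : ℝ) : EReal) + g θstar ≤ ((f θ : ℝ) : EReal) + g θ)
    (hh : θstar ∈ effDom h) : θstar ∈ effDom h ∩ effDom g := by
  obtain ⟨q, hqh, hqg⟩ := hqual
  refine ⟨hh, ?_⟩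
  have h1 := hmin q (by
    rw [hX]; exact ⟨subset_closure (interior_subset hqh), subset_closure hqg⟩)
  rw [← coe_finPart hg.proper.1 hqg, ← EReal.coe_add] at h1
  refine (lt_top_iff_ne_top (a := g θstar)).mpr fun hcon => ?_
  rw [hcon, EReal.coe_add_top] at h1
  exact EReal.coe_ne_top _ (top_le_iff.mp h1)

/-- First-order optimality of the constrained minimizer. -/
lemma optimality (hg : IsProperLscConvex g) (hh : IsLegendre h)
    (hX : X = closure (effDom h) ∩ closure (effDom g)) (hS : S.IsHermitian)
    (hquad : ∀ θ, f θ = f θS + 1 / 2 * sqNorm S (θ - θS))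
    (hpD : θstar ∈ effDom h ∩ effDom g)
    (hmin : ∀ θ ∈ X, ((f θstar : ℝ) : EReal) + g θstar ≤ ((f θ : ℝ) : EReal) + g θ) :
    ∀ q ∈ effDom h ∩ effDom g,
      finPart g θstar - finPart g q ≤ bil S (θstar - θS) (q - θstar) := by
  have hconv : ConvexOn ℝ (effDom h ∩ effDom g) (finPart g) :=
    hg.convex.subset Set.inter_subset_right (hh.strictConvex.1.inter hg.convex.1)
  intro q hq
  refine inner_ge_of_isMin_quadratic hconv hS hpD (fun u hu => ?_) hq
  have h1 := hmin u (by rw [hX]; exact ⟨subset_closure hu.1, subset_closure hu.2⟩)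
  rw [← coe_finPart hg.proper.1 hu.2, ← coe_finPart hg.proper.1 hpD.2, ← EReal.coe_add,
    ← EReal.coe_add, EReal.coe_le_coe_iff, hquad θstar, hquad u] at h1
  linarith

end Optimality

end Model

end SDA

/-! ### Assembly of the final bound -/

theorem proposition5 {Ω : Type*} [MeasurableSpace Ω] (P : Measure Ω) [IsProbabilityMeasure P]
    (d : ℕ)
    -- the regularizer `g` and the Legendre function `h`
    (g h : EuclideanSpace ℝ (Fin d) → EReal)
    (hg : SDA.IsProperLscConvex g)
    (hh : SDA.IsLegendre h)
    (X : Set (EuclideanSpace ℝ (Fin d)))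
    (hX : X = closure (SDA.effDom h) ∩ closure (SDA.effDom g))
    (hXint : (interior X).Nonempty)
    (hqual : (interior (SDA.effDom h) ∩ SDA.effDom g).Nonempty)
    -- i.i.d. observations with finite variances
    (x : ℕ → Ω → EuclideanSpace ℝ (Fin d)) (y : ℕ → Ω → ℝ)
    (hx : ∀ n, Measurable (x n)) (hy : ∀ n, Measurable (y n))
    (hindep : iIndepFun (fun n ω => (x n ω, y n ω)) P)
    (hident : ∀ n, IdentDistrib (fun ω => (x n ω, y n ω)) (fun ω => (x 0 ω, y 0 ω)) P P)
    (hx2 : MemLp (x 0) 2 P) (hy2 : MemLp (y 0) 2 P)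
    -- population covariance
    (S : Matrix (Fin d) (Fin d) ℝ) (hS : S = SDA.secondMoment P (x 0)) (hSpos : S.PosDef)
    -- a minimizer of `ψ = f + g` over `X`, and the global minimizer of `f`
    (θstar θS : EuclideanSpace ℝ (Fin d))
    (hθstar : θstar ∈ X ∧
      ∀ θ ∈ X, ((SDA.risk P (x 0) (y 0) θstar : ℝ) : EReal) + g θstar
        ≤ ((SDA.risk P (x 0) (y 0) θ : ℝ) : EReal) + g θ)
    (hθS : ∀ θ, SDA.risk P (x 0) (y 0) θS ≤ SDA.risk P (x 0) (y 0) θ)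
    -- noise covariance
    (C : Matrix (Fin d) (Fin d) ℝ)
    (hC : C = SDA.secondMoment P (SDA.residual (x 0) (y 0) θS))
    (hξ : MemLp (SDA.residual (x 0) (y 0) θS) 2 P)
    (hσ : ∃ σ : ℝ, 0 < σ ∧ (σ ^ 2 • S - C).PosSemidef)
    -- bounded kurtosis
    (κ : ℝ) (hκ : 0 < κ)
    (hkurt : ∀ z : EuclideanSpace ℝ (Fin d),
      Integrable (fun ω => ⟪z, x 0 ω⟫_ℝ ^ 4) P ∧
        ∫ ω, ⟪z, x 0 ω⟫_ℝ ^ 4 ∂P ≤ κ * SDA.sqNorm S z ^ 2)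
    (hgnonneg : ∀ θ, 0 ≤ g θ)
    -- `L h - (1/2) ‖·‖_S ^ 2` is convex
    (L : ℝ) (hL : 0 < L)
    (hLconv : ConvexOn ℝ (SDA.effDom h)
      (fun θ => L * SDA.finPart h θ - 1 / 2 * SDA.sqNorm S θ))
    -- `h - (μ / 2) ‖·‖_{S ^ b} ^ 2` is convex
    (b μ : ℝ) (hb : b ∈ Set.Icc (0 : ℝ) 1) (hμ : 0 < μ)
    (hμconv : ConvexOn ℝ (SDA.effDom h)
      (fun θ => SDA.finPart h θ - μ / 2 * SDA.sqNorm (SDA.matPow S b) θ))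
    -- step-size
    (γ : ℝ) (hγ : 0 < γ)
    (hγ1 : γ ≤ μ / (4 * κ * (SDA.matPow S (1 - b)).trace))
    (hγ2 : γ ≤ 1 / (κ * L * d))
    -- the iterates
    (θ₀ : EuclideanSpace ℝ (Fin d)) (hθ₀ : θ₀ ∈ interior (SDA.effDom h))
    (η θ : ℕ → Ω → EuclideanSpace ℝ (Fin d))
    (hsda : SDA.IsSDA h g γ θ₀ x y η θ)
    (n : ℕ) (hn : 1 ≤ n) :
    ((∫⁻ ω, ENNReal.ofReal (1 / 2 * SDA.sqNorm S (SDA.average θ n ω - θstar)) ∂P : ℝ≥0∞) : EReal)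
      ≤ ((2 / (γ * n) : ℝ) : EReal) * SDA.bregman h θstar θ₀
        + ((24 / n * (S⁻¹ * C).trace
            + 16 * κ * d * γ / (n * μ) * (C * SDA.matPow S (-b)).trace
            + 8 * κ * d / n * (4 * κ * γ * (SDA.matPow S (1 - b)).trace / μ + 3)
                * SDA.sqNorm S (θstar - θS) : ℝ) : EReal)
        + ((80 * (κ * d / (γ * n ^ 2)) : ℝ) : EReal) * SDA.bregman h θstar θ₀
        + ((16 * κ * d / n ^ 2 : ℝ) : EReal) * g θ₀ := by
  have hn0 : (0 : ℝ) < n := by exact_mod_cast hn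
  -- For `d = 0` the step-size bound is a division by zero, valued `0`, against `γ > 0`.
  have hd : 0 < d := by
    rcases Nat.eq_zero_or_pos d with h0 | h0
    · rw [h0] at hγ2
      simp only [Nat.cast_zero, mul_zero, div_zero] at hγ2
      exact absurd hγ (not_lt.mpr hγ2)
    · exact h0
  have hd0 : (0 : ℝ) < d := by exact_mod_cast hd
  have hθ₀h : θ₀ ∈ SDA.effDom h := interior_subset hθ₀
  -- The right side is then `⊤`, provided no other summand is `⊥`, since `⊤ + ⊥ = ⊥` in `EReal`.
  by_cases hgθ₀ : g θ₀ = ⊤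
  · refine le_of_le_of_eq le_top (Eq.symm ?_)
    rw [hgθ₀, EReal.coe_mul_top_of_pos (by positivity)]
    refine EReal.add_top_of_ne_bot ?_
    have hbreg : ∀ c : ℝ, 0 < c → (c : EReal) * SDA.bregman h θstar θ₀ ≠ ⊥ := by
      intro c hc
      by_cases htop : h θstar = ⊤
      · rw [SDA.bregman, htop, EReal.top_sub_coe, EReal.coe_mul_top_of_pos hc]
        exact top_ne_bot
      · rw [SDA.bregman, ← EReal.coe_toReal htop (hh.proper.1 _), ← EReal.coe_sub,
          ← EReal.coe_mul]
        exact EReal.coe_ne_bot _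
    exact EReal.add_ne_bot_iff.mpr ⟨EReal.add_ne_bot_iff.mpr ⟨hbreg _ (by positivity),
      EReal.coe_ne_bot _⟩, hbreg _ (by positivity)⟩
  have hgθ₀m : θ₀ ∈ SDA.effDom g := lt_top_iff_ne_top.mpr hgθ₀
  by_cases hhstar : h θstar = ⊤
  · refine le_of_le_of_eq le_top (Eq.symm ?_)
    rw [SDA.bregman, hhstar, EReal.top_sub_coe, EReal.coe_mul_top_of_pos (by positivity),
      EReal.coe_mul_top_of_pos (by positivity), EReal.top_add_coe, EReal.top_add_top,
      ← SDA.coe_finPart hg.proper.1 hgθ₀m, ← EReal.coe_mul, EReal.top_add_coe]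
  have hsamp := SDA.isSampling_of_iIndepFun hx hy hindep hident hx2 hy2 hS hθS hC hξ hkurt
  have hquad := SDA.risk_eq_add hx2 hy2 hθS
  rw [← hS] at hquad
  have hpD := SDA.isMin_mem_effDom hg hqual hX hθstar.2 (lt_top_iff_ne_top.mpr hhstar)
  have hopt := SDA.optimality hg hh hX hSpos.1 hquad hpD hθstar.2
  set M := SDA.matPow S b with hM
  set N := SDA.matPow S (-b) with hN
  have hMps : M.PosSemidef := SDA.posSemidef_matPow hSpos b
  have hNps : N.PosSemidef := SDA.posSemidef_matPow hSpos (-b)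
  have hMN : M * N = 1 := by
    rw [hM, hN, SDA.matPow_mul_matPow hSpos, add_neg_cancel, SDA.matPow_zero hSpos]
  have hNS : N * S = SDA.matPow S (1 - b) := by
    have h1 : N * SDA.matPow S 1 = SDA.matPow S (1 - b) := by
      rw [hN, SDA.matPow_mul_matPow hSpos]; congr 1; ring
    rwa [SDA.matPow_one hSpos] at h1
  set τ := (SDA.matPow S (1 - b)).trace with hτ
  -- A nonpositive denominator, zero included, would make the step-size bound nonpositive.
  have hτ0 : 0 < 4 * κ * τ := by
    by_contra hcon
    exact absurd hγ (not_lt.mpr (hγ1.trans (div_nonpos_of_nonneg_of_nonpos hμ.le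
      (not_lt.mp hcon))))
  have hstep : γ * (4 * κ * τ) ≤ μ := (le_div_iff₀ hτ0).mp hγ1
  have hsub := hsda.strong_subgradient hg hh hγ hgnonneg hMps hNps.1 hMN hμ hμconv hθ₀ hgθ₀m
  have hθm := fun k => (hsda.measurable hsamp k).2
  have hθ2 := fun k => (hsda.memLp hsamp hSpos hMps hNps.1 hMN hμ hpD hgnonneg hγ hsub k).2
  set K := SDA.finPart h θstar - SDA.finPart h θ₀
    - ⟪gradient (SDA.finPart h) θ₀, θstar - θ₀⟫_ℝ with hK
  have hK0 : 0 ≤ K := by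
    have := SDA.add_inner_gradient_le hh.strictConvex.convexOn hθ₀h (hh.differentiable _ hθ₀) hpD.1
    rw [hK]; linarith
  have hG0 : 0 ≤ SDA.finPart g θ₀ := EReal.toReal_nonneg (hgnonneg θ₀)
  have hA := SDA.sum_integral_sqNorm_le (p := θstar) (K := K + γ * SDA.finPart g θ₀)
    hsamp hSpos hθm hθ2 hNps hγ hμ (by rw [hNS]; exact hstep) n fun ω => by
      have := SDA.energy_inequality (t := fun k => θ k ω) (e := fun k => η k ω)
        (v := SDA.residuals x y θ ω) (h := h) (g := g) hMps hNps.1 hMN hSpos.1 hγ hμ hgnonneg hpD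
        (fun k => hsub k ω) (fun k => hsda.dual_succ_residual k ω) hopt n
      simp only [hsda.primal_zero, hsda.dual_zero] at this
      exact this
  have hB := SDA.half_integral_sqNorm_sum_le (p := θstar) (K := n * (2 / γ * K))
    hsamp hSpos hθm hθ2 n fun ω => by
      have := SDA.sqNorm_denoisedSum_le (t := fun k => θ k ω) (e := fun k => η k ω)
        (v := SDA.residuals x y θ ω) (h := h) (g := g) hMps hSpos hγ hμ hpD
        (fun k => hsub k ω) (fun k => hsda.dual_succ_residual k ω) hopt n
      simp only [hsda.primal_zero, hsda.dual_zero] at this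
      exact this
  -- A basis vector serves as the nonzero direction; it exists because `d > 0`.
  have hκ1 : 1 ≤ κ := by
    refine (hsamp.sample 0).one_le_kurtosis (w := EuclideanSpace.single ⟨0, hd⟩ 1) ?_
    exact SDA.sqNorm_pos hSpos (by simp)
  have hκd : 1 ≤ κ * d := by
    have : (1 : ℝ) ≤ d := by exact_mod_cast hd
    nlinarith
  have htrN : 0 ≤ (C * N).trace := by
    rw [hC, ← SDA.integral_sqNorm_eq_trace N hξ]
    exact integral_nonneg fun ω => SDA.sqNorm_nonneg hNps _
  have htrS : 0 ≤ (C * S⁻¹).trace := by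
    rw [hC, ← SDA.integral_sqNorm_eq_trace S⁻¹ hξ]
    exact integral_nonneg fun ω => SDA.sqNorm_nonneg hSpos.inv.posSemidef _
  have hQ := SDA.sqNorm_nonneg hSpos.posSemidef (θstar - θS)
  have havg : ∀ ω, 1 / 2 * SDA.sqNorm S (SDA.average θ n ω - θstar)
      = 1 / (n : ℝ) ^ 2 * (1 / 2 * SDA.sqNorm S (∑ k ∈ Finset.range n, (θ k ω - θstar))) := by
    intro ω
    have h1 : SDA.average θ n ω - θstar
        = (1 / (n : ℝ)) • ∑ k ∈ Finset.range n, (θ k ω - θstar) := by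
      rw [Finset.sum_sub_distrib _ fun _ => θstar, Finset.sum_const, Finset.card_range,
        ← Nat.cast_smul_eq_nsmul ℝ, smul_sub, smul_smul, one_div_mul_cancel hn0.ne', one_smul]
      rfl
    rw [h1, SDA.sqNorm_smul]; ring
  have hsum2 : MemLp (fun ω => ∑ k ∈ Finset.range n, (θ k ω - θstar)) 2 P :=
    memLp_finsetSum _ fun k _ => (hθ2 k).sub (memLp_const θstar)
  -- Square-integrability of the iterates turns the extended expectation into a real integral.
  have hlint : ((∫⁻ ω, ENNReal.ofReal (1 / 2 * SDA.sqNorm S (SDA.average θ n ω - θstar)) ∂P :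
      ℝ≥0∞) : EReal) = ((1 / (n : ℝ) ^ 2 *
        ∫ ω, 1 / 2 * SDA.sqNorm S (∑ k ∈ Finset.range n, (θ k ω - θstar)) ∂P : ℝ) : EReal) := by
    simp only [havg]
    have hpos : ∀ ω, 0 ≤ 1 / (n : ℝ) ^ 2
        * (1 / 2 * SDA.sqNorm S (∑ k ∈ Finset.range n, (θ k ω - θstar))) := fun ω =>
      mul_nonneg (by positivity) (mul_nonneg (by norm_num) (SDA.sqNorm_nonneg hSpos.posSemidef _))
    rw [← ofReal_integral_eq_lintegral_ofReal
      (((SDA.integrable_sqNorm S hsum2).const_mul (1 / 2)).const_mul (1 / (n : ℝ) ^ 2))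
      (Eventually.of_forall hpos), ← integral_const_mul, EReal.coe_ennreal_ofReal,
      max_eq_left (integral_nonneg hpos)]
  have hbreg : SDA.bregman h θstar θ₀ = ((K : ℝ) : EReal) := by
    rw [SDA.bregman, ← SDA.coe_finPart hh.proper.1 hpD.1, ← EReal.coe_sub, hK]
    congr 1; ring
  rw [hlint, hbreg, ← SDA.coe_finPart hg.proper.1 hgθ₀m]
  simp only [← EReal.coe_mul, ← EReal.coe_add, EReal.coe_le_coe_iff]
  rw [Matrix.trace_mul_comm S⁻¹ C]
  rw [hNS] at hA
  simp only [Finset.sum_add_distrib, ← Finset.mul_sum, Finset.sum_const, Finset.card_range,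
    nsmul_eq_mul] at hB
  exact SDA.combine_bounds hn0 hγ hμ hκd hK0 hG0 htrN htrS hQ (by linarith) (by linarith) hA
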